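/- Let $n\ge 1$, let $\Omega\subseteq\mathbb{R}^n$ be a non-empty, bounded, convex open set with smooth boundary, and let $G:\mathbb{R}^n\to\mathbb{R}$ be a smooth convex function with $G\ge 1$. For a positive definite symmetric matrix $A$ put $F(A)=\det(A)^{1/n}$. A function on $\overline\Omega$ is called smooth if for every finite $k$ it has a $C^k$ extension to $\mathbb{R}^n$, and a smooth function is called strictly convex if its Hessian is positive definite at every point of $\overline\Omega$. Write $\|u\|_k=\sum_{i=0}^k\sup_{\overline\Omega}\|D^iu\|$. Let $\phi:\overline\Omega\to\,]0,\infty[$ be smooth. Let $\hat f$ be a lower barrier, that is, a smooth strictly convex function on $\overline\Omega$ with $$F(D^2\hat f)/G(D\hat f)>\phi\ \text{ on }\overline\Omega,\qquad \hat f|_{\partial\Omega}=0,$$ and put $\delta(\hat f)=\inf_{x\in\overline\Omega}\bigl(F(D^2\hat f(x))-\phi(x)G(D\hat f(x))\bigr)>0$. Let $f$ be a smooth strictly convex function on $\overline\Omega$ with $$F(D^2f)/G(Df)=\phi\ \text{ on }\overline\Omega,\qquad f|_{\partial\Omega}=0,\qquad f\ge\hat f\ \text{ on }\overline\Omega.$$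 (1) (Boundary estimate.) There is a constant $C>0$ which, for fixed $n$, $\Omega$ and $G$, depends only on $\|\phi\|_1$, $\inf_{\overline\Omega}\phi$, $\delta(\hat f)$, $\|\hat f\|_2$ and $\|f\|_1$, such that $\|D^2f(x)\|\le C$ for all $x\in\partial\Omega$. (2) (Global estimate.) There is a constant $C>0$ which, for fixed $n$, $\Omega$ and $G$, depends only on $\|\phi\|_2$, $\inf_{\overline\Omega}\phi$, $\delta(\hat f)$, $\|\hat f\|_2$ and $\|f\|_1$, such that $\|f\|_2\le C$. In both parts the dependence is meant uniformly: given $K,L,M\in\mathbb{R}$ and $m,d>0$, one $C$ serves all $\phi,\hat f,f$ as above for which $\|\phi\|_1\le K$ (in (1)) respectively $\|\phi\|_2\le K$ (in (2)), $\inf_{\overline\Omega}\phi\ge m$, $\delta(\hat f)\ge d$, $\|\hat f\|_2\le L$ and $\|f\|_1\le M$. -/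

import Mathlib

open scoped ContDiff

noncomputable section

namespace CNS

/-- `f` is smooth on the closure of `Ω`: for every finite `k`, the restriction of `f` to the
closure of `Ω` extends to a `C^k` function on the whole space. -/
def SmoothOnClosure {n : ℕ} (Ω : Set (EuclideanSpace ℝ (Fin n)))
    (f : EuclideanSpace ℝ (Fin n) → ℝ) : Prop :=
  ∀ k : ℕ, ∃ g : EuclideanSpace ℝ (Fin n) → ℝ,
    ContDiff ℝ k g ∧ Set.EqOn f g (closure Ω)

/-- The open set `Ω` has smooth boundary: near each of its boundary points it is the strict
sublevel set of a smooth function without critical points. -/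
def HasSmoothBoundary {n : ℕ} (Ω : Set (EuclideanSpace ℝ (Fin n))) : Prop :=
  ∀ p ∈ frontier Ω, ∃ U : Set (EuclideanSpace ℝ (Fin n)), IsOpen U ∧ p ∈ U ∧
    ∃ ρ : EuclideanSpace ℝ (Fin n) → ℝ, ContDiffOn ℝ ∞ ρ U ∧
      (∀ x ∈ U, fderiv ℝ ρ x ≠ 0) ∧ Ω ∩ U = {x ∈ U | ρ x < 0}

/-- The `C^k` norm over the closure of `Ω`: the sum over `i ≤ k` of the suprema of `‖D^i f‖`. -/
def ckNorm {n : ℕ} (Ω : Set (EuclideanSpace ℝ (Fin n))) (k : ℕ)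
    (f : EuclideanSpace ℝ (Fin n) → ℝ) : ℝ :=
  ∑ i ∈ Finset.range (k + 1), ⨆ x : closure Ω, ‖iteratedFDerivWithin ℝ i f (closure Ω) x‖

/-- The infimum of `f` over the closure of `Ω`. -/
def infOnClosure {n : ℕ} (Ω : Set (EuclideanSpace ℝ (Fin n)))
    (f : EuclideanSpace ℝ (Fin n) → ℝ) : ℝ :=
  ⨅ x : closure Ω, f x

/-- The gradient of `f` at a point of the closure of `Ω`, up to the boundary. -/
def grad {n : ℕ} (Ω : Set (EuclideanSpace ℝ (Fin n)))
    (f : EuclideanSpace ℝ (Fin n) → ℝ) (x : EuclideanSpace ℝ (Fin n)) :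
    EuclideanSpace ℝ (Fin n) :=
  gradientWithin f (closure Ω) x

/-- The Hessian matrix of `f` at a point of the closure of `Ω`, up to the boundary. -/
def hess {n : ℕ} (Ω : Set (EuclideanSpace ℝ (Fin n)))
    (f : EuclideanSpace ℝ (Fin n) → ℝ) (x : EuclideanSpace ℝ (Fin n)) :
    Matrix (Fin n) (Fin n) ℝ :=
  Matrix.of fun i j => iteratedFDerivWithin ℝ 2 f (closure Ω) x
    ![EuclideanSpace.single i 1, EuclideanSpace.single j 1]

/-- `F(A) = det(A)^(1/n)`. It is only used at positive definite matrices. -/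
def F {n : ℕ} (A : Matrix (Fin n) (Fin n) ℝ) : ℝ :=
  A.det ^ (1 / (n : ℝ))

/-- `f` is smooth and strictly convex, i.e. its Hessian is positive definite, on the closure
of `Ω`. -/
structure IsSmoothStrictlyConvex {n : ℕ} (Ω : Set (EuclideanSpace ℝ (Fin n)))
    (f : EuclideanSpace ℝ (Fin n) → ℝ) : Prop where
  smooth : SmoothOnClosure Ω f
  posDef : ∀ x ∈ closure Ω, (hess Ω f x).PosDef

/-- `f` is a smooth strictly convex solution of `F(D²f)/G(Df) = φ`, `f = 0` on `∂Ω`. -/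
structure IsSolution {n : ℕ} (Ω : Set (EuclideanSpace ℝ (Fin n)))
    (G φ f : EuclideanSpace ℝ (Fin n) → ℝ) : Prop where
  convex : IsSmoothStrictlyConvex Ω f
  eqn : ∀ x ∈ closure Ω, F (hess Ω f x) / G (grad Ω f x) = φ x
  boundary : ∀ x ∈ frontier Ω, f x = 0

/-- `f` is a lower barrier: it is smooth and strictly convex and satisfies
`F(D²f)/G(Df) > φ`, `f = 0` on `∂Ω`. -/
structure IsLowerBarrier {n : ℕ} (Ω : Set (EuclideanSpace ℝ (Fin n)))
    (G φ f : EuclideanSpace ℝ (Fin n) → ℝ) : Prop where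
  convex : IsSmoothStrictlyConvex Ω f
  ineq : ∀ x ∈ closure Ω, φ x < F (hess Ω f x) / G (grad Ω f x)
  boundary : ∀ x ∈ frontier Ω, f x = 0

/-- `δ(f)`: the infimum over the closure of `Ω` of `F(D²f) - φ G(Df)`. -/
def barrierGap {n : ℕ} (Ω : Set (EuclideanSpace ℝ (Fin n)))
    (G φ f : EuclideanSpace ℝ (Fin n) → ℝ) : ℝ :=
  infOnClosure Ω fun x => F (hess Ω f x) - φ x * G (grad Ω f x)

end CNS

end

open scoped ContDiff

noncomputable section

namespace CNS

/-! ### Partial derivatives on Euclidean space and the maximum principle -/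

section

/-! Two structural facts carry the proof. F = det^(1/n) is concave and homogeneous of degree one on
positive definite matrices, so F(B) ≤ ⟨dF(A), B⟩ with equality at B = A (`F_le_dF`, `dF_self`); and
the convex function G lies above its tangent planes (`add_fderiv_le`). Freezing coefficients at x
turns the equation into an inequality with equality at x. The first and second derivative tests
there give the equation differentiated once, and an inequality for two derivatives, in terms of L =
Σ aᵢⱼ∂ᵢ∂ⱼ − Σ bₖ∂ₖ, without differentiating F (`Admissible.linearization`). The same two facts give
L(h − f) ≥ c(1 + tr a) for a lower barrier h (`Admissible.exists_barrier`).

At the boundary D²f is estimated by directions. Tangential: f and h both vanish on ∂Ω, so on tangent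
vectors D²f is μ D²h with μ between positive constants (`boundary_proportional`). Mixed: tangential
derivatives of f vanish on ∂Ω, and L of them is O(1 + tr a); a multiple of f − h therefore dominates
them, with equality on ∂Ω, which bounds their transversal derivatives
(`Admissible.exists_tangential_le`, `Admissible.exists_mixed_le`). Transversal: det D²f is bounded
and D²f is bounded below on the tangent space (`exists_qf_le_of_hyperplane`). The tangential fields
require a defining function of Ω; one fixed solution plays this role for all others.

In the interior, the maximum principle is applied to tr D²f + (A/2)|Df|²
(`Admissible.exists_trace_le`). L(|Df|²/2) contains the term (F/n) tr D²f, which for large A beats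
the error, linear in tr D²f, of the twice differentiated equation. As D²f is positive definite, its
trace controls its norm. -/

/-- Euclidean space of dimension `n`. -/
abbrev Eu (n : ℕ) : Type := EuclideanSpace ℝ (Fin n)

/-- The `i`-th partial derivative. -/
def pd {n : ℕ} (i : Fin n) (u : Eu n → ℝ) (x : Eu n) : ℝ :=
  fderiv ℝ u x (EuclideanSpace.single i 1)

/-- The Hessian matrix of a function on the whole space. -/
def hm {n : ℕ} (u : Eu n → ℝ) (x : Eu n) : Matrix (Fin n) (Fin n) ℝ :=
  Matrix.of fun i j => pd i (pd j u) x

/-- The quadratic form of a matrix. -/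
def qf {n : ℕ} (A : Matrix (Fin n) (Fin n) ℝ) (v : Fin n → ℝ) : ℝ :=
  ∑ i, ∑ j, v i * v j * A i j

/-- The second order operator `∑ aᵢⱼ ∂ᵢ∂ⱼ w - ∑ bₖ ∂ₖ w` at the point `x`. -/
def lop {n : ℕ} (a : Matrix (Fin n) (Fin n) ℝ) (b : Fin n → ℝ) (w : Eu n → ℝ) (x : Eu n) : ℝ :=
  (∑ i, ∑ j, a i j * pd i (pd j w) x) - ∑ k, b k * pd k w x

variable {n : ℕ} {u v w : Eu n → ℝ} {x : Eu n}

lemma contDiff_pd {k m : ℕ∞ω} (i : Fin n) (hu : ContDiff ℝ m u) (h : k + 1 ≤ m) :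
    ContDiff ℝ k (pd i u) :=
  (hu.fderiv_right h).clm_apply contDiff_const

lemma hm_apply (i j : Fin n) : hm u x i j = pd i (pd j u) x := rfl

lemma eu_eq_sum (y : Eu n) : y = ∑ i, y i • EuclideanSpace.single i (1 : ℝ) := by
  ext j
  simp [Finset.sum_apply, Pi.single_apply]

lemma fderiv_eq_sum (u : Eu n → ℝ) (x y : Eu n) : fderiv ℝ u x y = ∑ i, y i * pd i u x := by
  conv_lhs => rw [eu_eq_sum y]
  simp [pd]

lemma gradient_apply (u : Eu n → ℝ) (x : Eu n) (i : Fin n) : gradient u x i = pd i u x := by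
  have h := InnerProductSpace.toDual_symm_apply (𝕜 := ℝ) (x := EuclideanSpace.single i (1 : ℝ))
    (y := fderiv ℝ u x)
  rw [pd, ← h, real_inner_comm, EuclideanSpace.inner_single_left]
  simp [gradient]

lemma snd_fderiv_apply (hu : ContDiff ℝ 2 u) (i j : Fin n) (x : Eu n) :
    fderiv ℝ (fderiv ℝ u) x (EuclideanSpace.single i 1) (EuclideanSpace.single j 1) =
      pd i (pd j u) x := by
  have hd : DifferentiableAt ℝ (fderiv ℝ u) x :=
    (hu.fderiv_right (m := 1) (by norm_num)).differentiable (by norm_num) x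
  change _ = fderiv ℝ (fun y => fderiv ℝ u y (EuclideanSpace.single j 1)) x _
  rw [fderiv_clm_apply hd (differentiableAt_const _)]
  simp

lemma pd_comm (hu : ContDiff ℝ 2 u) (i j : Fin n) (x : Eu n) :
    pd i (pd j u) x = pd j (pd i u) x := by
  have hs : IsSymmSndFDerivAt ℝ u x := hu.contDiffAt.isSymmSndFDerivAt (by simp)
  rw [← snd_fderiv_apply hu, ← snd_fderiv_apply hu]
  exact hs _ _

section Rules

variable (i : Fin n)

lemma pd_add (hu : ContDiff ℝ 1 u) (hv : ContDiff ℝ 1 v) :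
    pd i (fun y => u y + v y) = fun y => pd i u y + pd i v y := by
  ext y
  simp [pd, fderiv_fun_add (hu.differentiable one_ne_zero y) (hv.differentiable one_ne_zero y)]

lemma pd_sub (hu : ContDiff ℝ 1 u) (hv : ContDiff ℝ 1 v) :
    pd i (fun y => u y - v y) = fun y => pd i u y - pd i v y := by
  ext y
  simp [pd, fderiv_fun_sub (hu.differentiable one_ne_zero y) (hv.differentiable one_ne_zero y)]

lemma pd_mul (hu : ContDiff ℝ 1 u) (hv : ContDiff ℝ 1 v) :
    pd i (fun y => u y * v y) = fun y => u y * pd i v y + v y * pd i u y := by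
  ext y
  simp [pd, fderiv_fun_mul (hu.differentiable one_ne_zero y) (hv.differentiable one_ne_zero y)]

lemma pd_const_mul (c : ℝ) (hu : ContDiff ℝ 1 u) :
    pd i (fun y => c * u y) = fun y => c * pd i u y := by
  ext y
  simp [pd, fderiv_const_mul (hu.differentiable one_ne_zero y)]

lemma pd_const (c : ℝ) : pd i (fun _ : Eu n => c) = fun _ => 0 := by
  ext y
  simp [pd]

lemma pd_sum {ι : Type*} (s : Finset ι) {f : ι → Eu n → ℝ} (hf : ∀ k ∈ s, ContDiff ℝ 1 (f k)) :
    pd i (fun y => ∑ k ∈ s, f k y) = fun y => ∑ k ∈ s, pd i (f k) y := by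
  ext y
  simp [pd, fderiv_fun_sum (fun k hk => (hf k hk).differentiable one_ne_zero y)]

lemma pd_coord (k : Fin n) : pd i (fun y : Eu n => y k) = fun _ => if i = k then 1 else 0 := by
  ext y
  have : fderiv ℝ (fun y : Eu n => y k) y = EuclideanSpace.proj k :=
    (EuclideanSpace.proj (𝕜 := ℝ) k : Eu n →L[ℝ] ℝ).fderiv
  rw [pd, this]
  simp [eq_comm]

end Rules

section Lop

variable (a : Matrix (Fin n) (Fin n) ℝ) (b : Fin n → ℝ)

lemma lop_add (hu : ContDiff ℝ 2 u) (hv : ContDiff ℝ 2 v) (x : Eu n) :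
    lop a b (fun y => u y + v y) x = lop a b u x + lop a b v x := by
  have h1 : ∀ j, pd j (fun y => u y + v y) = fun y => pd j u y + pd j v y := fun j =>
    pd_add j (hu.of_le (by norm_num)) (hv.of_le (by norm_num))
  have h2 : ∀ i j, pd i (fun y => pd j u y + pd j v y) =
      fun y => pd i (pd j u) y + pd i (pd j v) y := fun i j =>
    pd_add i (contDiff_pd j hu (by norm_num)) (contDiff_pd j hv (by norm_num))
  simp only [lop, h1, h2, mul_add, Finset.sum_add_distrib]
  ring

lemma lop_const_mul (c : ℝ) (hu : ContDiff ℝ 2 u) (x : Eu n) :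
    lop a b (fun y => c * u y) x = c * lop a b u x := by
  have h1 : ∀ j, pd j (fun y => c * u y) = fun y => c * pd j u y := fun j =>
    pd_const_mul j c (hu.of_le (by norm_num))
  have h2 : ∀ i j, pd i (fun y => c * pd j u y) = fun y => c * pd i (pd j u) y := fun i j =>
    pd_const_mul i c (contDiff_pd j hu (by norm_num))
  simp only [lop, h1, h2, mul_sub, Finset.mul_sum]
  congr 1
  · exact Finset.sum_congr rfl fun i _ => Finset.sum_congr rfl fun j _ => by ring
  · exact Finset.sum_congr rfl fun i _ => by ring

lemma lop_sub (hu : ContDiff ℝ 2 u) (hv : ContDiff ℝ 2 v) (x : Eu n) :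
    lop a b (fun y => u y - v y) x = lop a b u x - lop a b v x := by
  have h := lop_add a b hu (v := fun y => (-1) * v y) (contDiff_const.mul hv) x
  rw [lop_const_mul a b (-1) hv] at h
  simpa [sub_eq_add_neg] using h

lemma lop_sum {ι : Type*} (s : Finset ι) {f : ι → Eu n → ℝ} (hf : ∀ k ∈ s, ContDiff ℝ 2 (f k))
    (x : Eu n) : lop a b (fun y => ∑ k ∈ s, f k y) x = ∑ k ∈ s, lop a b (f k) x := by
  classical
  induction s using Finset.induction_on with
  | empty => simp [lop, pd_const]
  | insert k s hk ih =>
    simp only [Finset.sum_insert hk]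
    have hs : ∀ j ∈ s, ContDiff ℝ 2 (f j) := fun j hj => hf j (Finset.mem_insert_of_mem hj)
    rw [lop_add a b (hf k (Finset.mem_insert_self k s)) (ContDiff.sum hs), ih hs]

lemma lop_mul (ha : ∀ i j, a i j = a j i) (hu : ContDiff ℝ 2 u) (hv : ContDiff ℝ 2 v) (x : Eu n) :
    lop a b (fun y => u y * v y) x = u x * lop a b v x + v x * lop a b u x +
      2 * ∑ i, ∑ j, a i j * (pd i u x * pd j v x) := by
  have hu1 : ContDiff ℝ 1 u := hu.of_le (by norm_num)
  have hv1 : ContDiff ℝ 1 v := hv.of_le (by norm_num)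
  have h1 : ∀ j, pd j (fun y => u y * v y) = fun y => u y * pd j v y + v y * pd j u y :=
    fun j => pd_mul j hu1 hv1
  have hp : ∀ j, ContDiff ℝ 1 (pd j u) := fun j => contDiff_pd j hu (by norm_num)
  have hq : ∀ j, ContDiff ℝ 1 (pd j v) := fun j => contDiff_pd j hv (by norm_num)
  have h2 : ∀ i j, pd i (fun y => u y * pd j v y + v y * pd j u y) = fun y =>
      (u y * pd i (pd j v) y + pd j v y * pd i u y) +
      (v y * pd i (pd j u) y + pd j u y * pd i v y) := fun i j => by
    rw [pd_add i (hu1.mul (hq j)) (hv1.mul (hp j)), pd_mul i hu1 (hq j), pd_mul i hv1 (hp j)]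
  have h3 : ∑ i, ∑ j, a i j * (pd j u x * pd i v x) = ∑ i, ∑ j, a i j * (pd i u x * pd j v x) := by
    rw [Finset.sum_comm]
    exact Finset.sum_congr rfl fun i _ => Finset.sum_congr rfl fun j _ => by rw [ha j i]
  simp only [lop, h1, h2]
  have h4 : ∀ i j, a i j * (u x * pd i (pd j v) x + pd j v x * pd i u x +
      (v x * pd i (pd j u) x + pd j u x * pd i v x)) =
      u x * (a i j * pd i (pd j v) x) + v x * (a i j * pd i (pd j u) x) +
      (a i j * (pd i u x * pd j v x) + a i j * (pd j u x * pd i v x)) := fun i j => by ring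
  have h5 : ∀ k, b k * (u x * pd k v x + v x * pd k u x) =
      u x * (b k * pd k v x) + v x * (b k * pd k u x) := fun k => by ring
  simp only [h4, h5, Finset.sum_add_distrib, ← Finset.mul_sum, h3]
  ring

end Lop

lemma hasDerivAt_line (hw : ContDiff ℝ 1 w) (x y : Eu n) (t : ℝ) :
    HasDerivAt (fun s : ℝ => w (x + s • y)) (∑ i, y i * pd i w (x + t • y)) t := by
  have h1 : HasDerivAt (fun s : ℝ => x + s • y) y t := by
    simpa using ((hasDerivAt_id t).smul_const y).const_add x
  have h2 := (hw.differentiable one_ne_zero (x + t • y)).hasFDerivAt.comp_hasDerivAt t h1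
  rwa [fderiv_eq_sum] at h2

lemma deriv_line (hw : ContDiff ℝ 1 w) (x y : Eu n) :
    deriv (fun s : ℝ => w (x + s • y)) = fun t => ∑ i, y i * pd i w (x + t • y) :=
  funext fun t => (hasDerivAt_line hw x y t).deriv

lemma deriv_deriv_line (hw : ContDiff ℝ 2 w) (x y : Eu n) (t : ℝ) :
    deriv (deriv (fun s : ℝ => w (x + s • y))) t = qf (hm w (x + t • y)) y := by
  rw [deriv_line (hw.of_le (by norm_num))]
  have h : HasDerivAt (fun s : ℝ => ∑ i, y i * pd i w (x + s • y))
      (∑ i, y i * ∑ j, y j * pd j (pd i w) (x + t • y)) t := by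
    apply HasDerivAt.fun_sum
    intro i _
    exact (hasDerivAt_line (contDiff_pd i hw (by norm_num)) x y t).const_mul (y i)
  rw [h.deriv, qf]
  refine Finset.sum_congr rfl fun i _ => ?_
  rw [Finset.mul_sum]
  refine Finset.sum_congr rfl fun j _ => ?_
  rw [hm_apply, pd_comm hw i j]
  ring

/-- Were the value negative, the second derivative test would make `t` a local maximum as well. Then
`φ` is constant near `t` and the second derivative is 0. -/
lemma deriv_deriv_nonneg_of_isLocalMin {φ : ℝ → ℝ} {t : ℝ} (hφ : ContinuousAt φ t)
    (h : IsLocalMin φ t) : 0 ≤ deriv (deriv φ) t := by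
  by_contra! hneg
  have h0 : deriv φ t = 0 := h.deriv_eq_zero
  have hmax := isLocalMax_of_deriv_deriv_neg hneg h0 hφ
  have hc : φ =ᶠ[nhds t] fun _ => φ t := by
    filter_upwards [h, hmax] with s h1 h2 using le_antisymm h2 h1
  have h2 : deriv φ =ᶠ[nhds t] fun _ => 0 := by
    simpa using hc.deriv
  have := h2.deriv_eq
  simp only [deriv_const] at this
  linarith

lemma pd_eq_zero_of_isLocalMin (h : IsLocalMin w x) (i : Fin n) : pd i w x = 0 := by
  simp [pd, h.fderiv_eq_zero]

lemma qf_nonneg_of_isLocalMin (hw : ContDiff ℝ 2 w) (h : IsLocalMin w x) (y : Fin n → ℝ) :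
    0 ≤ qf (hm w x) y := by
  have h1 := deriv_deriv_line hw x (WithLp.toLp 2 y) 0
  simp only [zero_smul, add_zero] at h1
  rw [← h1]
  have hc : Continuous fun s : ℝ => x + s • (WithLp.toLp 2 y : Eu n) := by fun_prop
  apply deriv_deriv_nonneg_of_isLocalMin (hw.continuous.comp hc).continuousAt
  have : IsLocalMin w ((fun s : ℝ => x + s • (WithLp.toLp 2 y : Eu n)) 0) := by simpa using h
  exact IsLocalMin.comp_continuous (g := fun s : ℝ => x + s • (WithLp.toLp 2 y : Eu n)) this
    hc.continuousAt

lemma hm_neg (hw : ContDiff ℝ 2 w) (x : Eu n) : hm (fun y => -w y) x = -hm w x := by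
  ext i j
  have h1 : pd j (fun y => -w y) = fun y => (-1) * pd j w y := by
    have := pd_const_mul j (-1) (hw.of_le (by norm_num) : ContDiff ℝ 1 w)
    simpa using this
  have h2 := pd_const_mul i (-1) (contDiff_pd j hw (by norm_num) : ContDiff ℝ 1 (pd j w))
  rw [hm_apply, h1, h2]
  simp [hm_apply]

lemma qf_neg (A : Matrix (Fin n) (Fin n) ℝ) (y : Fin n → ℝ) : qf (-A) y = -qf A y := by
  simp [qf]

/-- A weak maximum principle: a function which is at most `B` on the boundary and at all interior
points where its first derivative vanishes and its Hessian is nonpositive is at most `B`. -/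
lemma le_of_critical_le {Ω : Set (Eu n)} (hO : IsOpen Ω) (hb : Bornology.IsBounded Ω) {B : ℝ}
    (hw : ContDiff ℝ 2 w) (hbd : ∀ x ∈ frontier Ω, w x ≤ B)
    (hin : ∀ x ∈ Ω, (∀ i, pd i w x = 0) → (∀ y, qf (hm w x) y ≤ 0) → w x ≤ B) :
    ∀ x ∈ closure Ω, w x ≤ B := by
  intro x hx
  have hc : IsCompact (closure Ω) := hb.isCompact_closure
  obtain ⟨z, hz, hmax⟩ := hc.exists_isMaxOn ⟨x, hx⟩ hw.continuous.continuousOn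
  refine (hmax hx).trans ?_
  by_cases hzO : z ∈ Ω
  · have hloc : IsLocalMax w z :=
      hmax.isLocalMax (Filter.mem_of_superset (hO.mem_nhds hzO) subset_closure)
    have hneg : IsLocalMin (fun y => -w y) z := hloc.neg
    refine hin z hzO (fun i => by simp [pd, hloc.fderiv_eq_zero]) fun y => ?_
    have h := qf_nonneg_of_isLocalMin hw.neg hneg y
    rw [hm_neg hw, qf_neg] at h
    linarith
  · refine hbd z ?_
    rw [hO.frontier_eq]
    exact ⟨hz, hzO⟩

end

/-! ### Positive definite matrices and the concavity of det^(1/n) -/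

section

open Matrix

variable {n : ℕ}

lemma qf_eq_dotProduct (A : Matrix (Fin n) (Fin n) ℝ) (v : Fin n → ℝ) :
    qf A v = v ⬝ᵥ (A *ᵥ v) := by
  simp only [qf, dotProduct, mulVec, Finset.mul_sum]
  exact Finset.sum_congr rfl fun i _ => Finset.sum_congr rfl fun j _ => by ring

lemma qf_nonneg {A : Matrix (Fin n) (Fin n) ℝ} (hA : A.PosSemidef) (v : Fin n → ℝ) :
    0 ≤ qf A v := by
  rw [qf_eq_dotProduct]
  simpa using hA.dotProduct_mulVec_nonneg v

lemma exists_sq_factor {a : Matrix (Fin n) (Fin n) ℝ} (ha : a.PosSemidef) :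
    ∃ C : Matrix (Fin n) (Fin n) ℝ, a = Cᵀ * C := by
  open scoped MatrixOrder in
  obtain ⟨C, hC⟩ := CStarAlgebra.nonneg_iff_eq_star_mul_self.mp (nonneg_iff_posSemidef.mpr ha)
  exact ⟨C, by simpa [star_eq_conjTranspose] using hC⟩

/-- With a positive semidefinite matrix written as `Cᵀ * C`, its pairing with `W` is a sum of values
of the quadratic form of `W`. Bounds on that form thus become the trace inequalities below. -/
lemma sum_sq_factor (C W : Matrix (Fin n) (Fin n) ℝ) :
    ∑ i, ∑ j, (Cᵀ * C) i j * W i j = ∑ k, qf W (C k) := by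
  simp only [mul_apply, transpose_apply, qf, Finset.sum_mul]
  rw [Finset.sum_comm' (t' := Finset.univ) (s' := fun _ => Finset.univ) (by simp)]
  rw [Finset.sum_comm]
  conv_lhs =>
    enter [2, i]
    rw [Finset.sum_comm]
  rw [Finset.sum_comm]

lemma sum_mul_nonpos {a W : Matrix (Fin n) (Fin n) ℝ} (ha : a.PosSemidef)
    (hW : ∀ v, qf W v ≤ 0) : ∑ i, ∑ j, a i j * W i j ≤ 0 := by
  obtain ⟨C, rfl⟩ := exists_sq_factor ha
  rw [sum_sq_factor]
  exact Finset.sum_nonpos fun k _ => hW _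

lemma sum_mul_ge {a B : Matrix (Fin n) (Fin n) ℝ} (ha : a.PosSemidef) {l : ℝ}
    (hB : ∀ v, l * ∑ i, v i ^ 2 ≤ qf B v) : l * a.trace ≤ ∑ i, ∑ j, a i j * B i j := by
  obtain ⟨C, rfl⟩ := exists_sq_factor ha
  rw [sum_sq_factor]
  have : (Cᵀ * C).trace = ∑ k, ∑ i, C k i ^ 2 := by
    simp only [trace, diag_apply, mul_apply, transpose_apply, pow_two]
    exact Finset.sum_comm
  rw [this, Finset.mul_sum]
  exact Finset.sum_le_sum fun k _ => hB _

lemma qf_le_of_entries {A : Matrix (Fin n) (Fin n) ℝ} {c : ℝ} (hA : ∀ i j, |A i j| ≤ c)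
    (v : Fin n → ℝ) : qf A v ≤ n * c * ∑ i, v i ^ 2 := by
  have h : ∀ i j, v i * v j * A i j ≤ c / 2 * (v i ^ 2 + v j ^ 2) := fun i j => by
    have hc : 0 ≤ c := (abs_nonneg _).trans (hA i j)
    have h1 : v i * v j * A i j ≤ |v i * v j| * c := by
      refine (le_abs_self _).trans ?_
      rw [abs_mul]
      exact mul_le_mul_of_nonneg_left (hA i j) (abs_nonneg _)
    have h2 : |v i * v j| ≤ (v i ^ 2 + v j ^ 2) / 2 := by
      rw [abs_le]
      constructor <;> nlinarith [sq_nonneg (v i - v j), sq_nonneg (v i + v j)]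
    nlinarith
  calc qf A v ≤ ∑ i, ∑ j, c / 2 * (v i ^ 2 + v j ^ 2) :=
        Finset.sum_le_sum fun i _ => Finset.sum_le_sum fun j _ => h i j
    _ = n * c * ∑ i, v i ^ 2 := by
        simp only [← Finset.mul_sum, Finset.sum_add_distrib, Finset.sum_const, Finset.card_univ,
          Fintype.card_fin, nsmul_eq_mul]
        ring

lemma abs_sum_mul_le {a W : Matrix (Fin n) (Fin n) ℝ} (ha : a.PosSemidef) {c : ℝ}
    (hW : ∀ i j, |W i j| ≤ c) : |∑ i, ∑ j, a i j * W i j| ≤ n * c * a.trace := by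
  have key : ∀ V : Matrix (Fin n) (Fin n) ℝ, (∀ i j, |V i j| ≤ c) →
      -(n * c * a.trace) ≤ ∑ i, ∑ j, a i j * V i j := fun V hV => by
    have h := sum_mul_ge ha (l := -(n * c)) (B := V) fun v => by
      have := qf_le_of_entries (A := -V) (by simpa using hV) v
      rw [qf_neg] at this
      linarith
    linarith
  have h1 := key W hW
  have h2 := key (-W) (by simpa using hW)
  simp only [Matrix.neg_apply, mul_neg, Finset.sum_neg_distrib] at h2
  rw [abs_le]
  constructor <;> linarith

lemma F_pos {A : Matrix (Fin n) (Fin n) ℝ} (hA : A.PosDef) : 0 < F A :=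
  Real.rpow_pos_of_pos hA.det_pos _

lemma F_pow (hn : 0 < n) {A : Matrix (Fin n) (Fin n) ℝ} (hA : A.PosDef) : F A ^ n = A.det := by
  rw [F, ← Real.rpow_natCast, ← Real.rpow_mul hA.det_pos.le]
  rw [one_div, inv_mul_cancel₀ (by positivity), Real.rpow_one]

/-- The inequality of geometric and arithmetic means for the eigenvalues. -/
lemma F_le_trace (hn : 0 < n) {A : Matrix (Fin n) (Fin n) ℝ} (hA : A.PosSemidef) :
    F A ≤ A.trace / n := by
  have h := Real.geom_mean_le_arith_mean Finset.univ (fun _ : Fin n => (1 : ℝ))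
    hA.1.eigenvalues (fun _ _ => zero_le_one) (by simpa using hn)
    (fun i _ => hA.eigenvalues_nonneg i)
  have h1 := hA.1.det_eq_prod_eigenvalues
  have h2 := hA.1.trace_eq_sum_eigenvalues
  simp only [RCLike.ofReal_real_eq_id, id] at h1 h2
  simpa [F, h1, h2] using h

/-- The derivative of `F` at the positive definite matrix `A`. -/
def dF (A : Matrix (Fin n) (Fin n) ℝ) : Matrix (Fin n) (Fin n) ℝ := (F A / n) • A⁻¹

lemma dF_posSemidef {A : Matrix (Fin n) (Fin n) ℝ} (hA : A.PosDef) : (dF A).PosSemidef :=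
  hA.posSemidef.inv.smul (div_nonneg (F_pos hA).le (Nat.cast_nonneg n))

lemma dF_symm {A : Matrix (Fin n) (Fin n) ℝ} (hA : A.PosDef) (i j : Fin n) :
    dF A i j = dF A j i := by
  have := (dF_posSemidef hA).1.apply i j
  simpa using this.symm

/-- For A = D²f this removes a factor D²f from the cross terms of the product rule for `lop`: they
become bounded in `Admissible.lop_pd_mul_pd` and supply the good term in
`Admissible.exists_trace_le`. -/
lemma dF_mul {A : Matrix (Fin n) (Fin n) ℝ} (hA : A.PosDef) (i k : Fin n) :
    ∑ j, dF A i j * A j k = if i = k then F A / n else 0 := by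
  have : dF A * A = (F A / n) • (1 : Matrix (Fin n) (Fin n) ℝ) := by
    rw [dF, smul_mul, nonsing_inv_mul _ (isUnit_iff_ne_zero.mpr hA.det_pos.ne')]
  have h := congrFun (congrFun this i) k
  rw [mul_apply] at h
  rw [h]
  simp [one_apply]

/-- Concavity and homogeneity of `F`: it lies below its differential. -/
lemma F_le_dF (hn : 0 < n) {A B : Matrix (Fin n) (Fin n) ℝ} (hA : A.PosDef) (hB : B.PosDef) :
    F B ≤ ∑ i, ∑ j, dF A i j * B i j := by
  -- Conjugation by `C`, where A⁻¹ = CᵀC, reduces to the case A = 1: the conjugate of `B` has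
  -- determinant det B / det A and trace ⟨A⁻¹, B⟩, and the inequality of means applies to it.
  obtain ⟨C, hC⟩ := exists_sq_factor hA.posSemidef.inv
  have hP : (C * B * Cᵀ).PosSemidef := by
    simpa using hB.posSemidef.mul_mul_conjTranspose_same C
  have h1 := F_le_trace hn hP
  have hdet : (C * B * Cᵀ).det = A.det⁻¹ * B.det := by
    have : A.det⁻¹ = C.det * C.det := by
      have h := congrArg det hC
      rw [det_mul, det_transpose, det_nonsing_inv, Ring.inverse_eq_inv'] at h
      exact h
    rw [det_mul, det_mul, det_transpose, this]
    ring
  have hF : F A * F (C * B * Cᵀ) = F B := by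
    rw [F, F, F, hdet, ← Real.mul_rpow hA.det_pos.le
      (mul_nonneg (inv_nonneg.mpr hA.det_pos.le) hB.det_pos.le), ← mul_assoc,
      mul_inv_cancel₀ hA.det_pos.ne', one_mul]
  have htr : (C * B * Cᵀ).trace = ∑ i, ∑ j, A⁻¹ i j * B i j := by
    rw [hC, sum_sq_factor, trace]
    refine Finset.sum_congr rfl fun k _ => ?_
    rw [qf_eq_dotProduct, diag_apply, mul_assoc, mul_apply]
    rfl
  calc F B = F A * F (C * B * Cᵀ) := hF.symm
    _ ≤ F A * ((C * B * Cᵀ).trace / n) := mul_le_mul_of_nonneg_left h1 (F_pos hA).le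
    _ = ∑ i, ∑ j, dF A i j * B i j := by
        rw [htr]
        simp only [dF, Matrix.smul_apply, smul_eq_mul, mul_assoc, ← Finset.mul_sum]
        ring

lemma dF_self (hn : 0 < n) {A : Matrix (Fin n) (Fin n) ℝ} (hA : A.PosDef) :
    ∑ i, ∑ j, dF A i j * A i j = F A := by
  have h : ∀ i, ∑ j, dF A i j * A i j = F A / n := fun i => by
    have := dF_mul hA i i
    rw [if_pos rfl] at this
    rw [← this]
    exact Finset.sum_congr rfl fun j _ => by rw [← hA.1.apply i j]; simp
  simp only [h, Finset.sum_const, Finset.card_univ, Fintype.card_fin, nsmul_eq_mul]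
  field_simp

lemma qf_eq_sum_eigenvalues {A : Matrix (Fin n) (Fin n) ℝ} (hA : A.IsHermitian) (v : Fin n → ℝ) :
    ∃ w : Fin n → ℝ, ∑ i, w i ^ 2 = ∑ i, v i ^ 2 ∧ qf A v = ∑ i, hA.eigenvalues i * w i ^ 2 := by
  set U : Matrix (Fin n) (Fin n) ℝ := hA.eigenvectorUnitary.1 with hU
  have hUU : U * Uᵀ = 1 := by
    simpa [star_eq_conjTranspose] using Unitary.coe_mul_star_self hA.eigenvectorUnitary
  have hspec : A = U * diagonal hA.eigenvalues * Uᵀ := by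
    have := hA.spectral_theorem
    simpa [Unitary.conjStarAlgAut_apply, star_eq_conjTranspose, Function.comp_def] using this
  refine ⟨Uᵀ *ᵥ v, ?_, ?_⟩
  · have h : (Uᵀ *ᵥ v) ⬝ᵥ (Uᵀ *ᵥ v) = v ⬝ᵥ v := by
      rw [dotProduct_mulVec, vecMul_transpose, mulVec_mulVec, hUU, one_mulVec]
    simpa [dotProduct, pow_two] using h
  · rw [qf_eq_dotProduct]
    conv_lhs => rw [hspec]
    rw [← mulVec_mulVec, ← mulVec_mulVec, dotProduct_mulVec, ← mulVec_transpose]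
    simp only [dotProduct, mulVec_diagonal]
    exact Finset.sum_congr rfl fun i _ => by ring

lemma eigenvalues_eq_qf {A : Matrix (Fin n) (Fin n) ℝ} (hA : A.IsHermitian) (i : Fin n) :
    ∃ v : Fin n → ℝ, ∑ i, v i ^ 2 = 1 ∧ qf A v = hA.eigenvalues i := by
  refine ⟨hA.eigenvectorBasis i, ?_, ?_⟩
  · have := hA.eigenvectorBasis.norm_eq_one i
    rw [EuclideanSpace.norm_eq, Real.sqrt_eq_one] at this
    simpa using this
  · rw [qf_eq_dotProduct, hA.eigenvalues_eq]
    simp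

/-- A positive definite matrix that is bounded above and has determinant bounded below is
bounded below. -/
lemma le_qf_of_det_ge {A : Matrix (Fin n) (Fin n) ℝ} (hA : A.PosDef) {c L : ℝ} (hL : 0 < L)
    (hAL : ∀ v, qf A v ≤ L * ∑ i, v i ^ 2) (hdet : c ≤ A.det) (v : Fin n → ℝ) :
    c / L ^ (n - 1) * ∑ i, v i ^ 2 ≤ qf A v := by
  have hev : ∀ i, hA.1.eigenvalues i ≤ L := fun i => by
    obtain ⟨w, hw, hq⟩ := eigenvalues_eq_qf hA.1 i
    have := hAL w
    rwa [hw, mul_one, hq] at this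
  have hlow : ∀ i, c / L ^ (n - 1) ≤ hA.1.eigenvalues i := fun i => by
    rw [div_le_iff₀ (by positivity)]
    have h1 := hA.1.det_eq_prod_eigenvalues
    simp only [RCLike.ofReal_real_eq_id, id] at h1
    -- The determinant is the `i`-th eigenvalue times `n - 1` others, each at most `L`.
    rw [h1, ← Finset.mul_prod_erase _ _ (Finset.mem_univ i)] at hdet
    refine hdet.trans (mul_le_mul_of_nonneg_left ?_ (hA.eigenvalues_pos i).le)
    calc ∏ j ∈ Finset.univ.erase i, hA.1.eigenvalues j ≤ ∏ j ∈ Finset.univ.erase i, L :=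
          Finset.prod_le_prod (fun j _ => (hA.eigenvalues_pos j).le) fun j _ => hev j
      _ = L ^ (n - 1) := by simp
  obtain ⟨w, hw, hq⟩ := qf_eq_sum_eigenvalues hA.1 v
  rw [hq, ← hw, Finset.mul_sum]
  exact Finset.sum_le_sum fun i _ => mul_le_mul_of_nonneg_right (hlow i) (sq_nonneg _)

/-- A positive definite matrix that is bounded below and has determinant bounded above is
bounded above. -/
lemma qf_le_of_det_le {A : Matrix (Fin n) (Fin n) ℝ} (hA : A.PosDef) {c D : ℝ} (hc : 0 < c)
    (hAc : ∀ v, c * ∑ i, v i ^ 2 ≤ qf A v) (hdet : A.det ≤ D) (v : Fin n → ℝ) :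
    qf A v ≤ D / c ^ (n - 1) * ∑ i, v i ^ 2 := by
  have hev : ∀ i, c ≤ hA.1.eigenvalues i := fun i => by
    obtain ⟨w, hw, hq⟩ := eigenvalues_eq_qf hA.1 i
    have := hAc w
    rwa [hw, mul_one, hq] at this
  have hup : ∀ i, hA.1.eigenvalues i ≤ D / c ^ (n - 1) := fun i => by
    rw [le_div_iff₀ (by positivity)]
    have h1 := hA.1.det_eq_prod_eigenvalues
    simp only [RCLike.ofReal_real_eq_id, id] at h1
    rw [h1, ← Finset.mul_prod_erase _ _ (Finset.mem_univ i)] at hdet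
    refine le_trans (mul_le_mul_of_nonneg_left ?_ (hA.eigenvalues_pos i).le) hdet
    calc c ^ (n - 1) = ∏ j ∈ Finset.univ.erase i, c := by simp
      _ ≤ ∏ j ∈ Finset.univ.erase i, hA.1.eigenvalues j :=
          Finset.prod_le_prod (fun j _ => hc.le) fun j _ => hev j
  obtain ⟨w, hw, hq⟩ := qf_eq_sum_eigenvalues hA.1 v
  rw [hq, ← hw, Finset.mul_sum]
  exact Finset.sum_le_sum fun i _ => mul_le_mul_of_nonneg_right (hup i) (sq_nonneg _)

/-- Entries of a Gram matrix `Cᵀ * C` are inner products of columns of `C`, so each is at most the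
mean of two diagonal entries. -/
lemma abs_apply_le_trace {A : Matrix (Fin n) (Fin n) ℝ} (hA : A.PosSemidef) (i j : Fin n) :
    |A i j| ≤ A.trace := by
  have hd : ∀ k, A k k ≤ A.trace := fun k =>
    Finset.single_le_sum (f := fun k => A k k) (fun k _ => hA.diag_nonneg) (Finset.mem_univ k)
  obtain ⟨C, rfl⟩ := exists_sq_factor hA
  have h1 := hd i
  have h2 := hd j
  simp only [mul_apply, transpose_apply] at h1 h2 ⊢
  refine (Finset.abs_sum_le_sum_abs _ _).trans ?_
  have h3 : ∀ k, |C k i * C k j| ≤ (C k i * C k i + C k j * C k j) / 2 := fun k => by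
    rw [abs_le]
    constructor <;> nlinarith [sq_nonneg (C k i - C k j), sq_nonneg (C k i + C k j)]
  refine (Finset.sum_le_sum fun k _ => h3 k).trans ?_
  rw [← Finset.sum_div, Finset.sum_add_distrib]
  linarith

end

/-! ### Linearization of the equation and the barrier inequality -/

section

variable {n : ℕ}

lemma add_deriv_le {φ : ℝ → ℝ} (hφ : ConvexOn ℝ (Set.Icc 0 1) φ) {φ' : ℝ}
    (h : HasDerivAt φ φ' 0) : φ 0 + φ' ≤ φ 1 := by
  have := hφ.le_slope_of_hasDerivAt (by simp) (by simp) one_pos h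
  simp only [slope, sub_zero, inv_one, vsub_eq_sub, one_smul] at this
  linarith

/-- The subgradient inequality. -/
lemma add_fderiv_le {G : Eu n → ℝ} (hG : ContDiff ℝ 1 G) (hc : ConvexOn ℝ Set.univ G)
    (ξ η : Eu n) : G ξ + ∑ k, (η k - ξ k) * pd k G ξ ≤ G η := by
  have h1 := hasDerivAt_line hG ξ (η - ξ) 0
  have h2 : ConvexOn ℝ (Set.Icc (0 : ℝ) 1) fun s => G (ξ + s • (η - ξ)) := by
    have := (hc.comp_affineMap (AffineMap.lineMap ξ η)).subset
      (Set.subset_univ (Set.Icc (0 : ℝ) 1)) (convex_Icc 0 1)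
    refine this.congr fun s _ => ?_
    simp [AffineMap.lineMap_apply, add_comm]
  have := add_deriv_le h2 h1
  simpa using this

/-- The hypotheses of the a priori estimates, for globally defined functions and with pointwise
bounds. -/
structure Admissible (Ω : Set (Eu n)) (G : Eu n → ℝ) (K m d L M : ℝ) (ψ h f : Eu n → ℝ) :
    Prop where
  ψ_smooth : ContDiff ℝ 2 ψ
  h_smooth : ContDiff ℝ 2 h
  -- Order four, because the second order operator is applied to second derivatives of `f`.
  f_smooth : ContDiff ℝ 4 f
  ψ_ge : ∀ x ∈ closure Ω, m ≤ ψ x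
  ψ_le : ∀ x ∈ closure Ω, ψ x ≤ K
  pd_ψ_le : ∀ x ∈ closure Ω, ∀ i, |pd i ψ x| ≤ K
  h_pos : ∀ x ∈ closure Ω, (hm h x).PosDef
  h_gap : ∀ x ∈ closure Ω, d ≤ F (hm h x) - ψ x * G (gradient h x)
  pd_h_le : ∀ x ∈ closure Ω, ∀ i, |pd i h x| ≤ L
  hm_h_le : ∀ x ∈ closure Ω, ∀ i j, |hm h x i j| ≤ L
  h_bd : ∀ x ∈ frontier Ω, h x = 0
  f_pos : ∀ x ∈ closure Ω, (hm f x).PosDef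
  f_eq : ∀ x ∈ closure Ω, F (hm f x) = ψ x * G (gradient f x)
  pd_f_le : ∀ x ∈ closure Ω, ∀ i, |pd i f x| ≤ M
  f_bd : ∀ x ∈ frontier Ω, f x = 0
  h_le_f : ∀ x ∈ closure Ω, h x ≤ f x

/-- The first order coefficients of the linearized equation at `x`. -/
def drift (G ψ f : Eu n → ℝ) (x : Eu n) (k : Fin n) : ℝ := ψ x * pd k G (gradient f x)

section Contraction

variable (a : Matrix (Fin n) (Fin n) ℝ) (β : Fin n → ℝ) (k : Fin n) {f : Eu n → ℝ}

lemma contDiff_contract {p q : ℕ∞ω} (hf : ContDiff ℝ q f) (h : p + 1 + 1 ≤ q) :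
    ContDiff ℝ p fun y => ∑ i, ∑ j, a i j * pd i (pd j f) y :=
  ContDiff.sum fun i _ => ContDiff.sum fun j _ => contDiff_const.mul
    (contDiff_pd (m := p + 1) i (contDiff_pd j hf h) le_rfl)

lemma contDiff_sum_pd {p q : ℕ∞ω} (hf : ContDiff ℝ q f) (h : p + 1 ≤ q) :
    ContDiff ℝ p fun y => ∑ l, β l * pd l f y :=
  ContDiff.sum fun l _ => contDiff_const.mul (contDiff_pd l hf h)

lemma pd_sum_pd (hf : ContDiff ℝ 2 f) :
    pd k (fun y => ∑ l, β l * pd l f y) = fun y => ∑ l, β l * pd l (pd k f) y := by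
  have h1 : ∀ l, ContDiff ℝ 1 (pd l f) := fun l => contDiff_pd l hf (by norm_num)
  rw [pd_sum k _ fun l _ => contDiff_const.mul (h1 l)]
  ext y
  refine Finset.sum_congr rfl fun l _ => ?_
  rw [pd_const_mul k _ (h1 l), pd_comm hf]

/-- The coefficients are constants, frozen at one point, so differentiation passes through to `f`
and no derivative of `dF` appears. -/
lemma pd_contract (hf : ContDiff ℝ 3 f) :
    pd k (fun y => ∑ i, ∑ j, a i j * pd i (pd j f) y) =
      fun y => ∑ i, ∑ j, a i j * pd i (pd j (pd k f)) y := by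
  have h1 : ∀ j, ContDiff ℝ 2 (pd j f) := fun j => contDiff_pd j hf (by norm_num)
  have h2 : ∀ i j, ContDiff ℝ 1 (pd i (pd j f)) := fun i j => contDiff_pd i (h1 j) (by norm_num)
  rw [pd_sum k Finset.univ (f := fun i y => ∑ j, a i j * pd i (pd j f) y)
    fun i _ => ContDiff.sum fun j _ => contDiff_const.mul (h2 i j)]
  ext y
  refine Finset.sum_congr rfl fun i _ => ?_
  rw [pd_sum k Finset.univ (f := fun j y => a i j * pd i (pd j f) y)
    fun j _ => contDiff_const.mul (h2 i j)]
  refine Finset.sum_congr rfl fun j _ => ?_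
  rw [pd_const_mul k _ (h2 i j)]
  change a i j * pd k (pd i (pd j f)) y = _
  rw [pd_comm (h1 j) k i]
  have : pd k (pd j f) = pd j (pd k f) := funext fun z => pd_comm (hf.of_le (by norm_num)) k j z
  rw [this]

end Contraction

section Linearization

variable {Ω : Set (Eu n)} {G ψ h f : Eu n → ℝ} {K m d L M : ℝ}

/-- The equation differentiated once, and the inequality obtained by differentiating it twice,
at an interior point: by concavity of `F` and convexity of `G`, the linearization at `x` of the
equation is an inequality in `Ω` with equality at `x`. -/
lemma Admissible.linearization (hn : 0 < n) (hG : ContDiff ℝ 1 G) (hc : ConvexOn ℝ Set.univ G)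
    (hO : IsOpen Ω) (hm0 : 0 < m) (D : Admissible Ω G K m d L M ψ h f) {x : Eu n} (hx : x ∈ Ω)
    (k : Fin n) :
    lop (dF (hm f x)) (drift G ψ f x) (pd k f) x = pd k ψ x * G (gradient f x) ∧
    pd k (pd k ψ) x * G (gradient f x) +
        2 * (pd k ψ x * ∑ l, pd l G (gradient f x) * pd l (pd k f) x) ≤
      lop (dF (hm f x)) (drift G ψ f x) (pd k (pd k f)) x := by
  set a := dF (hm f x) with ha
  set β : Fin n → ℝ := fun l => pd l G (gradient f x) with hβ
  -- γ + Σ βₗ ∂ₗf is the tangent plane of `G` at Df(x), evaluated along Df: it lies below G(Df) and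
  -- agrees with it at `x`.
  set γ : ℝ := G (gradient f x) - ∑ l, β l * pd l f x with hγ
  have hxc : x ∈ closure Ω := subset_closure hx
  have hf3 : ContDiff ℝ 3 f := D.f_smooth.of_le (by norm_num)
  have hf2 : ContDiff ℝ 2 f := D.f_smooth.of_le (by norm_num)
  have hψ1 : ContDiff ℝ 1 ψ := D.ψ_smooth.of_le (by norm_num)
  have hk3 : ContDiff ℝ 3 (pd k f) := contDiff_pd k D.f_smooth (by norm_num)
  have hkψ : ContDiff ℝ 1 (pd k ψ) := contDiff_pd k D.ψ_smooth (by norm_num)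
  set S : Eu n → ℝ := fun y => ∑ i, ∑ j, a i j * pd i (pd j f) y with hS
  set ℓ : Eu n → ℝ := fun y => γ + ∑ l, β l * pd l f y with hℓ
  have hS2 : ContDiff ℝ 2 S := contDiff_contract a D.f_smooth (by norm_num)
  have hℓ2 : ContDiff ℝ 2 ℓ := contDiff_const.add (contDiff_sum_pd β hf3 (by norm_num))
  have hS1 : pd k S = fun y => ∑ i, ∑ j, a i j * pd i (pd j (pd k f)) y := pd_contract a k hf3
  have hS11 : pd k (pd k S) = fun y => ∑ i, ∑ j, a i j * pd i (pd j (pd k (pd k f))) y := by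
    rw [hS1, pd_contract a k hk3]
  have hℓ1 : pd k ℓ = fun y => ∑ l, β l * pd l (pd k f) y := by
    rw [hℓ, pd_add k contDiff_const (contDiff_sum_pd β hf2 (by norm_num)), pd_const,
      pd_sum_pd β k hf2]
    simp
  have hℓ11 : pd k (pd k ℓ) = fun y => ∑ l, β l * pd l (pd k (pd k f)) y := by
    rw [hℓ1, pd_sum_pd β k (hk3.of_le (by norm_num))]
  have hℓx : ℓ x = G (gradient f x) := by simp [hℓ, hγ]
  have hℓG : ∀ y, ℓ y ≤ G (gradient f y) := fun y => by
    refine le_trans (le_of_eq ?_) (add_fderiv_le hG hc (gradient f x) (gradient f y))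
    simp only [hℓ, hγ, hβ, gradient_apply, sub_mul, Finset.sum_sub_distrib, mul_comm]
    ring
  set Φ : Eu n → ℝ := fun y => S y - ψ y * ℓ y with hΦ
  have hΦ2 : ContDiff ℝ 2 Φ := hS2.sub (D.ψ_smooth.mul hℓ2)
  have hΦx : Φ x = 0 := by
    have := dF_self hn (D.f_pos x hxc)
    simp only [hΦ, hℓx, hS]
    simp only [hm_apply] at this
    rw [ha, this, D.f_eq x hxc, sub_self]
  -- On Ω, S ≥ F(D²f) by concavity and ψℓ ≤ ψG(Df) = F(D²f) by convexity and the equation, so Φ ≥ 0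
  -- = Φ(x). The two claims are the first and second derivative tests for Φ at `x`.
  have hmin : IsLocalMin Φ x := by
    filter_upwards [hO.mem_nhds hx] with y hy
    rw [hΦx]
    have hyc : y ∈ closure Ω := subset_closure hy
    have h1 := F_le_dF hn (D.f_pos x hxc) (D.f_pos y hyc)
    rw [D.f_eq y hyc] at h1
    have h2 := mul_le_mul_of_nonneg_left (hℓG y) (hm0.le.trans (D.ψ_ge y hyc))
    simp only [hm_apply] at h1
    have h3 : ψ y * G (gradient f y) ≤ S y := h1
    simp only [hΦ]
    linarith
  have hΦ1 : pd k Φ = fun y => pd k S y - (ψ y * pd k ℓ y + ℓ y * pd k ψ y) := by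
    rw [hΦ, pd_sub k (hS2.of_le (by norm_num)) (hψ1.mul (hℓ2.of_le (by norm_num))),
      pd_mul k hψ1 (hℓ2.of_le (by norm_num))]
  have hℓk : ContDiff ℝ 1 (pd k ℓ) := contDiff_pd k hℓ2 (by norm_num)
  have hΦ11 : pd k (pd k Φ) = fun y => pd k (pd k S) y -
      ((ψ y * pd k (pd k ℓ) y + pd k ℓ y * pd k ψ y) +
        (ℓ y * pd k (pd k ψ) y + pd k ψ y * pd k ℓ y)) := by
    have hl1 : ContDiff ℝ 1 ℓ := hℓ2.of_le (by norm_num)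
    rw [hΦ1, pd_sub k (contDiff_pd k hS2 (by norm_num)) ((hψ1.mul hℓk).add (hl1.mul hkψ)),
      pd_add k (hψ1.mul hℓk) (hl1.mul hkψ), pd_mul k hψ1 hℓk, pd_mul k hl1 hkψ]
  have hdrift : ∀ w : Eu n → ℝ, ∑ l, drift G ψ f x l * pd l w x = ψ x * ∑ l, β l * pd l w x :=
    fun w => by
      rw [Finset.mul_sum]
      exact Finset.sum_congr rfl fun l _ => by simp [drift, hβ, mul_assoc]
  constructor
  · have h0 := pd_eq_zero_of_isLocalMin hmin k
    rw [hΦ1, hS1, hℓ1] at h0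
    simp only [hℓx] at h0
    rw [lop, hdrift]
    linarith
  · have h0 := qf_nonneg_of_isLocalMin hΦ2 hmin (Pi.single k 1)
    have h1 : qf (hm Φ x) (Pi.single k 1) = pd k (pd k Φ) x := by
      rw [qf_eq_dotProduct]
      simp [hm_apply]
    rw [h1, hΦ11, hS11, hℓ11, hℓ1] at h0
    simp only [hℓx] at h0
    rw [lop, hdrift]
    linarith

/-- The lower barrier has uniformly positive Hessian. -/
lemma Admissible.exists_le_qf_h (hn : 0 < n) (hm0 : 0 < m) (hd0 : 0 < d) (K M : ℝ)
    (hG1 : ∀ ξ, 1 ≤ G ξ) (Ω : Set (Eu n)) (L : ℝ) :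
    ∃ l : ℝ, 0 < l ∧ ∀ ψ h f, Admissible Ω G K m d L M ψ h f → ∀ x ∈ closure Ω, ∀ v,
      l * ∑ i, v i ^ 2 ≤ qf (hm h x) v := by
  have hL : 0 < n * (|L| + 1) := by positivity
  -- The form of D²h is at most n(|L| + 1), and the gap condition with ψ ≥ m and G ≥ 1 gives F(D²h)
  -- ≥ m, hence det D²h ≥ mⁿ.
  refine ⟨m ^ n / (n * (|L| + 1)) ^ (n - 1), by positivity, fun ψ h f D x hx v => ?_⟩
  refine le_qf_of_det_ge (D.h_pos x hx) hL
    (fun v => qf_le_of_entries (fun i j => (D.hm_h_le x hx i j).trans ?_) v) ?_ v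
  · linarith [le_abs_self L]
  · rw [← F_pow hn (D.h_pos x hx)]
    refine pow_le_pow_left₀ hm0.le ?_ n
    have h1 := D.h_gap x hx
    have h2 := D.ψ_ge x hx
    nlinarith [hG1 (gradient h x)]

/-- The difference of the lower barrier and the solution is a strict subsolution of the
linearized equation. -/
lemma Admissible.exists_barrier (hn : 0 < n) (hG : ContDiff ℝ 1 G) (hc : ConvexOn ℝ Set.univ G)
    (hm0 : 0 < m) (hd0 : 0 < d) (K M : ℝ)
    (hG1 : ∀ ξ, 1 ≤ G ξ) (Ω : Set (Eu n)) (L : ℝ) :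
    ∃ c : ℝ, 0 < c ∧ ∀ ψ h f, Admissible Ω G K m d L M ψ h f → ∀ x ∈ closure Ω,
      c * (1 + (dF (hm f x)).trace) ≤
        lop (dF (hm f x)) (drift G ψ f x) (fun y => h y - f y) x := by
  obtain ⟨l, hl, H⟩ := Admissible.exists_le_qf_h hn hm0 hd0 K M hG1 Ω L
  set L' := |L| + 1 with hL'
  have hL'0 : 0 < L' := by positivity
  -- The bounds ⟨a, D²h⟩ ≥ F(D²h) and ⟨a, D²h⟩ ≥ l tr a are averaged with weights 1 − t and t. Since
  -- F(D²h) ≤ L', this `t` costs at most half of the gap `d`.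
  set t := d / (2 * L') with ht
  have ht0 : 0 < t := by positivity
  refine ⟨min (d / 2) (t * l), by positivity, fun ψ h f D x hx => ?_⟩
  set a := dF (hm f x) with ha
  have hps : a.PosSemidef := dF_posSemidef (D.f_pos x hx)
  have hFB : F (hm h x) ≤ L' := by
    refine (F_le_trace hn (D.h_pos x hx).posSemidef).trans ?_
    rw [div_le_iff₀ (by positivity)]
    calc (hm h x).trace ≤ ∑ _i : Fin n, L' :=
          Finset.sum_le_sum fun i _ => (le_abs_self _).trans ((D.hm_h_le x hx i i).trans
            ((le_abs_self L).trans (by linarith)))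
      _ = L' * n := by simp [mul_comm]
  have h1 := F_le_dF hn (D.f_pos x hx) (D.h_pos x hx)
  have h2 := sum_mul_ge hps (H ψ h f D x hx)
  have h3 := dF_self hn (D.f_pos x hx)
  have h4 := D.f_eq x hx
  have h5 := D.h_gap x hx
  have hψ : 0 < ψ x := hm0.trans_le (D.ψ_ge x hx)
  -- By the subgradient inequality at Df(x), the drift applied to h − f is at most ψ(G(Dh) − G(Df)).
  -- The terms in `f` then cancel by the equation, leaving ⟨a, D²h⟩ − ψG(Dh).
  have h6 := mul_le_mul_of_nonneg_left
    (add_fderiv_le hG hc (gradient f x) (gradient h x)) hψ.le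
  have h7 : ψ x * ∑ k, (gradient h x k - gradient f x k) * pd k G (gradient f x) =
      (∑ k, drift G ψ f x k * pd k h x) - ∑ k, drift G ψ f x k * pd k f x := by
    rw [← Finset.sum_sub_distrib, Finset.mul_sum]
    refine Finset.sum_congr rfl fun k _ => ?_
    rw [gradient_apply, gradient_apply, drift]
    ring
  have hdB : d ≤ L' := by
    have := hG1 (gradient h x)
    nlinarith
  have ht1 : t ≤ 1 := by
    rw [ht, div_le_one (by positivity)]
    linarith
  have htL : t * L' = d / 2 := by
    rw [ht]
    field_simp
  have htr : 0 ≤ a.trace := hps.trace_nonneg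
  rw [lop_sub _ _ D.h_smooth (D.f_smooth.of_le (by norm_num)), lop, lop]
  simp only [hm_apply] at h1 h2 h3
  rw [← ha] at h1 h3
  set X := ∑ i, ∑ j, a i j * pd i (pd j h) x
  set Y := ∑ i, ∑ j, a i j * pd i (pd j f) x
  have h8 : d / 2 + t * l * a.trace ≤ X - ψ x * G (gradient h x) := by
    have e1 : (1 - t) * F (hm h x) ≤ (1 - t) * X :=
      mul_le_mul_of_nonneg_left h1 (by linarith)
    have e2 : t * (l * a.trace) ≤ t * X := mul_le_mul_of_nonneg_left h2 ht0.le
    have e3 : t * F (hm h x) ≤ t * L' := mul_le_mul_of_nonneg_left hFB ht0.le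
    nlinarith
  have h9 : min (d / 2) (t * l) * (1 + a.trace) ≤ d / 2 + t * l * a.trace := by
    have e1 : min (d / 2) (t * l) ≤ d / 2 := min_le_left _ _
    have e2 : min (d / 2) (t * l) ≤ t * l := min_le_right _ _
    nlinarith
  rw [mul_add, h7] at h6
  linarith

end Linearization

end

/-! ### Tangential derivatives dominated by the barrier -/

section

variable {n : ℕ}

lemma continuous_pd {u : Eu n → ℝ} (hu : ContDiff ℝ 1 u) (i : Fin n) : Continuous (pd i u) :=
  (contDiff_pd (k := 0) i hu (by norm_num)).continuous

lemma norm_le_sum_abs (ξ : Eu n) : ‖ξ‖ ≤ ∑ i, |ξ i| := by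
  conv_lhs => rw [eu_eq_sum ξ]
  refine (norm_sum_le _ _).trans (le_of_eq ?_)
  simp [norm_smul]

lemma exists_abs_le_of_isCompact {s : Set (Eu n)} (hs : IsCompact s) {ι : Type*} [Fintype ι]
    {u : ι → Eu n → ℝ} (hu : ∀ i, Continuous (u i)) :
    ∃ C : ℝ, 0 < C ∧ ∀ i, ∀ x ∈ s, |u i x| ≤ C := by
  obtain ⟨C, hC⟩ := hs.exists_bound_of_continuousOn
    (f := fun x => ∑ i, |u i x|) (continuous_finsetSum _ fun i _ => (hu i).abs).continuousOn
  refine ⟨|C| + 1, by positivity, fun i x hx => ?_⟩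
  have h1 := (le_abs_self _).trans (hC x hx)
  have h2 : |u i x| ≤ ∑ i, |u i x| :=
    Finset.single_le_sum (f := fun i => |u i x|) (fun i _ => abs_nonneg _) (Finset.mem_univ i)
  linarith [le_abs_self C]

/-- The bounds on `G` and its derivatives come from compactness: coordinates of size at most `M`
place the vector in the ball of radius nM. -/
lemma exists_bound_of_coord {G : Eu n → ℝ} (hG : ContDiff ℝ 1 G) (M : ℝ) :
    ∃ Γ : ℝ, 0 < Γ ∧ ∀ ξ : Eu n, (∀ i, |ξ i| ≤ M) → G ξ ≤ Γ ∧ ∀ k, |pd k G ξ| ≤ Γ := by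
  have hs : IsCompact (Metric.closedBall (0 : Eu n) (n * M)) := isCompact_closedBall _ _
  obtain ⟨C, hC0, hC⟩ := exists_abs_le_of_isCompact hs (u := fun k => pd k G)
    fun k => continuous_pd hG k
  obtain ⟨C', hC'0, hC'⟩ := exists_abs_le_of_isCompact hs (u := fun _ : Unit => G)
    fun _ => hG.continuous
  refine ⟨C + C', by positivity, fun ξ hξ => ?_⟩
  have hm : ξ ∈ Metric.closedBall (0 : Eu n) (n * M) := by
    rw [mem_closedBall_zero_iff]
    refine (norm_le_sum_abs ξ).trans ((Finset.sum_le_sum fun i _ => hξ i).trans ?_)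
    simp
  refine ⟨?_, fun k => ?_⟩
  · linarith [le_abs_self (G ξ), hC' () ξ hm]
  · linarith [hC k ξ hm]

section Mixed

variable {Ω : Set (Eu n)} {G ψ h f ρ : Eu n → ℝ} {K m d L M : ℝ}

/-- The linearized operator applied to `∂_q ρ ∂_p f`. -/
lemma Admissible.lop_pd_mul_pd (hn : 0 < n) (hG : ContDiff ℝ 1 G)
    (hc : ConvexOn ℝ Set.univ G) (hO : IsOpen Ω) (hm0 : 0 < m)
    (D : Admissible Ω G K m d L M ψ h f) (hρ : ContDiff ℝ 3 ρ) {x : Eu n} (hx : x ∈ Ω)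
    (p q : Fin n) :
    lop (dF (hm f x)) (drift G ψ f x) (fun y => pd q ρ y * pd p f y) x =
      pd q ρ x * (pd p ψ x * G (gradient f x)) +
      pd p f x * lop (dF (hm f x)) (drift G ψ f x) (pd q ρ) x +
      2 * (F (hm f x) / n * pd p (pd q ρ) x) := by
  have hxc := subset_closure hx
  rw [lop_mul _ _ (dF_symm (D.f_pos x hxc)) (contDiff_pd q hρ (by norm_num))
    (contDiff_pd p D.f_smooth (by norm_num)),
    (D.linearization hn hG hc hO hm0 hx p).1]
  congr 2
  have hf2 : ContDiff ℝ 2 f := D.f_smooth.of_le (by norm_num)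
  have h : ∀ i, ∑ j, dF (hm f x) i j * (pd i (pd q ρ) x * pd j (pd p f) x) =
      pd i (pd q ρ) x * if i = p then F (hm f x) / n else 0 := fun i => by
    rw [← dF_mul (D.f_pos x hxc) i p, Finset.mul_sum]
    exact Finset.sum_congr rfl fun j _ => by rw [hm_apply]; ring
  simp only [h, mul_ite, mul_zero, Finset.sum_ite_eq', Finset.mem_univ, if_true]
  ring

lemma abs_lop_le {a : Matrix (Fin n) (Fin n) ℝ} (ha : a.PosSemidef) {b : Fin n → ℝ} {B R : ℝ}
    (hb : ∀ k, |b k| ≤ B) {w : Eu n → ℝ} {x : Eu n} (h1 : ∀ k, |pd k w x| ≤ R)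
    (h2 : ∀ i j, |pd i (pd j w) x| ≤ R) :
    |lop a b w x| ≤ n * R * a.trace + n * (B * R) := by
  have e1 := abs_sum_mul_le ha (W := hm w x) h2
  have e2 : |∑ k, b k * pd k w x| ≤ n * (B * R) := by
    refine (Finset.abs_sum_le_sum_abs _ _).trans ?_
    calc ∑ k, |b k * pd k w x| ≤ ∑ _k : Fin n, B * R := Finset.sum_le_sum fun k _ => by
          rw [abs_mul]
          exact mul_le_mul (hb k) (h1 k) (abs_nonneg _) ((abs_nonneg _).trans (hb k))
      _ = n * (B * R) := by simp
  exact (abs_sub _ _).trans (add_le_add e1 e2)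

/-- The derivatives of the solution along the fields `∂_q ρ ∂_p - ∂_p ρ ∂_q` tangential to the
boundary are controlled by the difference of the solution and the barrier. -/
lemma Admissible.exists_tangential_le (hn : 0 < n) (hG : ContDiff ℝ 1 G)
    (hc : ConvexOn ℝ Set.univ G) (hG1 : ∀ ξ, 1 ≤ G ξ) (hO : IsOpen Ω)
    (hb : Bornology.IsBounded Ω) (hm0 : 0 < m) (hd0 : 0 < d) (hρ : ContDiff ℝ 3 ρ)
    (K L M : ℝ) :
    ∃ A : ℝ, ∀ ψ h f, Admissible Ω G K m d L M ψ h f →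
      (∀ x ∈ frontier Ω, ∀ p q, pd q ρ x * pd p f x = pd p ρ x * pd q f x) →
      ∀ p q, ∀ x ∈ closure Ω,
        A * (h x - f x) + (pd q ρ x * pd p f x - pd p ρ x * pd q f x) ≤ 0 := by
  obtain ⟨c, hc0, hbar⟩ := Admissible.exists_barrier hn hG hc hm0 hd0 K M hG1 Ω L
  obtain ⟨Γ, hΓ0, hΓ⟩ := exists_bound_of_coord hG M
  have hK := hb.isCompact_closure
  have hρ1 : ∀ q, ContDiff ℝ 2 (pd q ρ) := fun q => contDiff_pd q hρ (by norm_num)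
  have hρ2 : ∀ p q, ContDiff ℝ 1 (pd p (pd q ρ)) := fun p q =>
    contDiff_pd p (hρ1 q) (by norm_num)
  obtain ⟨R1, hR10, hR1⟩ := exists_abs_le_of_isCompact hK (u := fun q => pd q ρ)
    fun q => (hρ1 q).continuous
  obtain ⟨R2, hR20, hR2⟩ := exists_abs_le_of_isCompact hK
    (u := fun i : Fin n × Fin n => pd i.1 (pd i.2 ρ)) fun i => (hρ2 i.1 i.2).continuous
  obtain ⟨R3, hR30, hR3⟩ := exists_abs_le_of_isCompact hK
    (u := fun i : Fin n × Fin n × Fin n => pd i.1 (pd i.2.1 (pd i.2.2 ρ)))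
    fun i => continuous_pd (hρ2 i.2.1 i.2.2) i.1
  set R := R1 + R2 + R3 with hR
  set C := R * (K * Γ) + M * (n * R + n * (K * Γ * R)) + 2 * (K * Γ * R) with hC
  -- L of each of the two products is at most C(1 + tr a) in absolute value, while this multiple of
  -- the barrier contributes at least (2C + 1)(1 + tr a). So L of the sum is positive, which
  -- excludes an interior maximum.
  refine ⟨(2 * C + 1) / c, fun ψ h f D hT p q => ?_⟩
  have hf1 : ∀ p, ContDiff ℝ 2 (pd p f) := fun p => contDiff_pd p D.f_smooth (by norm_num)
  have hf2 : ContDiff ℝ 2 f := D.f_smooth.of_le (by norm_num)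
  have hhf : ContDiff ℝ 2 fun y => h y - f y := D.h_smooth.sub hf2
  have htan : ContDiff ℝ 2 fun y => pd q ρ y * pd p f y - pd p ρ y * pd q f y :=
    ((hρ1 q).mul (hf1 p)).sub ((hρ1 p).mul (hf1 q))
  have hAhf : ContDiff ℝ 2 fun y => (2 * C + 1) / c * (h y - f y) := contDiff_const.mul hhf
  refine le_of_critical_le hO hb (hAhf.add htan) (fun x hx => ?_) fun x hx h1 h2 => ?_
  · rw [D.h_bd x hx, D.f_bd x hx, hT x hx p q]
    simp
  · exfalso
    have hxc := subset_closure hx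
    set a := dF (hm f x) with ha
    set b := drift G ψ f x with hbdef
    have hps : a.PosSemidef := dF_posSemidef (D.f_pos x hxc)
    have htr := hps.trace_nonneg
    have hneg := sum_mul_nonpos hps h2
    have hlop := lop_add a b hAhf htan x
    have hle : lop a b (fun y => (2 * C + 1) / c * (h y - f y) +
        (pd q ρ y * pd p f y - pd p ρ y * pd q f y)) x ≤ 0 := by
      rw [lop]
      simp only [h1, mul_zero, Finset.sum_const_zero, sub_zero]
      exact hneg
    rw [hlop, lop_const_mul a b _ hhf,
      lop_sub a b ((hρ1 q).mul (hf1 p)) ((hρ1 p).mul (hf1 q))] at hle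
    have hg := hΓ (gradient f x) fun i => by rw [gradient_apply]; exact D.pd_f_le x hxc i
    have hG0 : 0 < G (gradient f x) := zero_lt_one.trans_le (hG1 _)
    have hψ0 : 0 < ψ x := hm0.trans_le (D.ψ_ge x hxc)
    have hK0 : 0 ≤ K := hψ0.le.trans (D.ψ_le x hxc)
    have hM0 : 0 ≤ M := (abs_nonneg _).trans (D.pd_f_le x hxc p)
    have hbk : ∀ k, |b k| ≤ K * Γ := fun k => by
      rw [hbdef, drift, abs_mul, abs_of_pos hψ0]
      exact mul_le_mul (D.ψ_le x hxc) (hg.2 k) (abs_nonneg _) hK0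
    have hF : |F (hm f x) / n| ≤ K * Γ := by
      rw [D.f_eq x hxc, abs_of_pos (by positivity)]
      refine (div_le_self (by positivity) (by exact_mod_cast hn)).trans ?_
      exact mul_le_mul (D.ψ_le x hxc) hg.1 hG0.le hK0
    have key : ∀ p q, |lop a b (fun y => pd q ρ y * pd p f y) x| ≤ C * (1 + a.trace) :=
      fun p q => by
        rw [D.lop_pd_mul_pd hn hG hc hO hm0 hρ hx p q]
        have e1 : |pd q ρ x| ≤ R := (hR1 q x hxc).trans (by linarith)
        have e2 : |pd p ψ x * G (gradient f x)| ≤ K * Γ := by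
          rw [abs_mul, abs_of_pos hG0]
          exact mul_le_mul (D.pd_ψ_le x hxc p) hg.1 hG0.le hK0
        have e3 : |lop a b (pd q ρ) x| ≤ n * R * a.trace + n * (K * Γ * R) :=
          abs_lop_le hps hbk (fun k => (hR2 (k, q) x hxc).trans (by linarith))
            fun i j => (hR3 (i, j, q) x hxc).trans (by linarith)
        have e4 : |pd p (pd q ρ) x| ≤ R := (hR2 (p, q) x hxc).trans (by linarith)
        have e5 := mul_le_mul e1 e2 (abs_nonneg _) (by positivity)
        have e6 := mul_le_mul (D.pd_f_le x hxc p) e3 (abs_nonneg _) hM0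
        have e7 := mul_le_mul hF e4 (abs_nonneg _) (by positivity)
        rw [← abs_mul] at e5 e6 e7
        refine (abs_add_three _ _ _).trans ?_
        rw [abs_mul 2, abs_two]
        have e8 : 0 ≤ (R * (K * Γ) + M * (n * (K * Γ * R)) + 2 * (K * Γ * R)) * a.trace := by
          positivity
        have e9 : 0 ≤ M * (n * R) := by positivity
        rw [hC]
        linarith
    have k1 := neg_le_of_abs_le (key p q)
    have k2 := le_of_abs_le (key q p)
    have k3 := hbar ψ h f D x hxc
    have hC0 : 0 ≤ C := by positivity
    have k4 := mul_le_mul_of_nonneg_left k3 (by positivity : 0 ≤ (2 * C + 1) / c)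
    have k5 : (2 * C + 1) / c * (c * (1 + a.trace)) = (2 * C + 1) * (1 + a.trace) := by
      field_simp
    rw [k5] at k4
    linarith

end Mixed

end

/-! ### Boundary points: Taylor expansion, tangent directions and comparison -/

section

open Filter Topology

variable {n : ℕ} {u w : Eu n → ℝ} {Ω : Set (Eu n)}

lemma exists_eq_add_pd (hw : ContDiff ℝ 1 w) (x y : Eu n) :
    ∃ θ ∈ Set.Ioo (0 : ℝ) 1, w (x + y) = w x + ∑ i, y i * pd i w (x + θ • y) := by
  obtain ⟨θ, hθ, h⟩ := exists_hasDerivAt_eq_slope (fun s : ℝ => w (x + s • y)) _ one_pos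
    (fun t _ => (hasDerivAt_line hw x y t).continuousAt.continuousWithinAt)
    fun t _ => hasDerivAt_line hw x y t
  refine ⟨θ, hθ, ?_⟩
  rw [h]
  simp

/-- Taylor's formula of order two with Lagrange remainder. -/
lemma exists_eq_add_qf (hw : ContDiff ℝ 2 w) (x y : Eu n) :
    ∃ θ ∈ Set.Ioo (0 : ℝ) 1,
      w (x + y) = w x + (∑ i, y i * pd i w x) + qf (hm w (x + θ • y)) y / 2 := by
  have hw1 : ContDiff ℝ 1 w := hw.of_le (by norm_num)
  set φ : ℝ → ℝ := fun s => w (x + s • y)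
  set φ' : ℝ → ℝ := fun s => ∑ i, y i * pd i w (x + s • y) with hφ'
  have h1 : ∀ t, HasDerivAt φ (φ' t) t := hasDerivAt_line hw1 x y
  have h2 : ∀ t, HasDerivAt φ' (qf (hm w (x + t • y)) y) t := fun t => by
    have hd : Differentiable ℝ φ' := by
      have : ContDiff ℝ 1 φ' := by
        refine ContDiff.sum fun i _ => contDiff_const.mul ?_
        exact (contDiff_pd (k := 1) i hw (by norm_num)).comp
          (contDiff_const.add (contDiff_id.smul contDiff_const))
      exact this.differentiable one_ne_zero
    rw [← deriv_deriv_line hw x y t, deriv_line hw1]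
    exact (hd t).hasDerivAt
  set R := φ 1 - φ 0 - φ' 0 with hR
  -- Rolle's theorem: with this `R` the auxiliary function equals φ(1) at both 0 and 1, and its
  -- derivative is (1 − t)(φ''(t) − 2R).
  have h3 : ∀ t, HasDerivAt (fun t => φ t + φ' t * (1 - t) + R * (1 - t) ^ 2)
      (φ' t + (qf (hm w (x + t • y)) y * (1 - t) + φ' t * (-1)) +
        R * (2 * (1 - t) * (-1))) t := fun t => by
    have e : HasDerivAt (fun t : ℝ => 1 - t) (-1) t := by
      simpa using (hasDerivAt_id t).const_sub 1
    refine ((h1 t).add ((h2 t).mul e)).add ?_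
    simpa using (e.pow 2).const_mul R
  obtain ⟨θ, hθ, h⟩ := exists_hasDerivAt_eq_zero one_pos
    (fun t _ => (h3 t).continuousAt.continuousWithinAt)
    (by simp only [hR]; ring) fun t _ => h3 t
  refine ⟨θ, hθ, ?_⟩
  have h4 : (1 - θ) * (qf (hm w (x + θ • y)) y - 2 * R) = 0 := by linarith
  have h5 : 1 - θ ≠ 0 := by linarith [hθ.2]
  have h6 := (mul_eq_zero.mp h4).resolve_left h5
  have h7 : φ 1 = w (x + y) := by simp [φ]
  have h8 : φ 0 = w x := by simp [φ]
  have h9 : φ' 0 = ∑ i, y i * pd i w x := by simp [φ']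
  rw [← h7, ← h8, ← h9]
  linarith

/-- A function with nonnegative Hessian lies above its tangents. -/
lemma pd_sum_le_sub (hw : ContDiff ℝ 2 w) {s : Set (Eu n)} (hs : Convex ℝ s)
    (hpos : ∀ x ∈ s, (hm w x).PosDef) {x y : Eu n} (hx : x ∈ s) (hy : y ∈ s) :
    ∑ i, (y i - x i) * pd i w x ≤ w y - w x := by
  obtain ⟨θ, hθ, h⟩ := exists_eq_add_qf hw x (y - x)
  have hz : x + θ • (y - x) ∈ s := hs.add_smul_sub_mem hx hy ⟨hθ.1.le, hθ.2.le⟩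
  have h1 := qf_nonneg (hpos _ hz).posSemidef (y - x : Eu n)
  simp only [add_sub_cancel, PiLp.sub_apply] at h h1
  linarith

lemma exists_mem_frontier_of_isPreconnected {S : Set (Eu n)} (hS : IsPreconnected S)
    (hO : IsOpen Ω) (h1 : (S ∩ Ω).Nonempty) (h2 : (S ∩ Ωᶜ).Nonempty) :
    (S ∩ frontier Ω).Nonempty := by
  by_contra hne
  have hfr : ∀ y ∈ S, y ∉ frontier Ω := fun y hy hf => hne ⟨y, hy, hf⟩
  have hnc : ∀ y ∈ S, y ∉ Ω → y ∈ (closure Ω)ᶜ := fun y hy hyO hyc =>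
    hfr y hy (by rw [hO.frontier_eq]; exact ⟨hyc, hyO⟩)
  obtain ⟨z, hz, hzO⟩ := h2
  obtain ⟨y, -, hy1, hy2⟩ := hS Ω (closure Ω)ᶜ hO isClosed_closure.isOpen_compl
    (fun y hy => (em (y ∈ Ω)).imp id (hnc y hy)) h1 ⟨z, hz, hnc z hz hzO⟩
  exact hy2 (subset_closure hy1)

/-- A vector annihilated by the derivative of a defining function is a limit of directions to
points of the boundary. -/
lemma exists_frontier_seq (hO : IsOpen Ω) (hcv : Convex ℝ Ω) (hu : ContDiff ℝ 1 u)
    (hu0 : ∀ x ∈ frontier Ω, u x = 0) {x₀ c : Eu n} (hx₀ : x₀ ∈ frontier Ω) (hc : c ∈ Ω)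
    (hneg : ∀ y ∈ Ω, ∑ i, (y i - x₀ i) * pd i u x₀ < 0) (τ : Eu n)
    (hτ : ∑ i, τ i * pd i u x₀ = 0) :
    ∃ (t : ℕ → ℝ) (z : ℕ → Eu n), (∀ j, 0 < t j) ∧ Tendsto t atTop (𝓝 0) ∧
      (∀ j, x₀ + z j ∈ frontier Ω) ∧ Tendsto (fun j => (t j)⁻¹ • z j) atTop (𝓝 τ) := by
  set N : Eu n := x₀ - c with hN
  set g : Eu n → ℝ := fun x => ∑ i, N i * pd i u x with hg
  have hgc : Continuous g := continuous_finsetSum _ fun i _ =>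
    continuous_const.mul (continuous_pd hu i)
  have hκ : 0 < g x₀ := by
    have := hneg c hc
    have e : g x₀ = -∑ i, (c i - x₀ i) * pd i u x₀ := by
      rw [← Finset.sum_neg_distrib]
      refine Finset.sum_congr rfl fun i _ => ?_
      simp only [hN, PiLp.sub_apply]
      ring
    linarith
  set κ := g x₀ with hκdef
  obtain ⟨r, hr, hball⟩ : ∃ r > 0, ∀ z, ‖z‖ < r → κ / 2 ≤ g (x₀ + z) := by
    have h1 : ∀ᶠ x in 𝓝 x₀, κ / 2 < g x :=
      hgc.continuousAt.eventually (lt_mem_nhds (by linarith))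
    obtain ⟨r, hr, h⟩ := Metric.eventually_nhds_iff.mp h1
    exact ⟨r, hr, fun z hz => (h (by simpa using hz)).le⟩
  obtain ⟨s₁, hs₁, hs₁1, hs₁r⟩ : ∃ s₁ : ℝ, 0 < s₁ ∧ s₁ ≤ 1 ∧ s₁ * ‖N‖ < r / 2 := by
    refine ⟨min 1 (r / 2 / (‖N‖ + 1)), by positivity, min_le_left _ _, ?_⟩
    have h1 : min 1 (r / 2 / (‖N‖ + 1)) * ‖N‖ ≤ r / 2 / (‖N‖ + 1) * ‖N‖ :=
      mul_le_mul_of_nonneg_right (min_le_right _ _) (norm_nonneg _)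
    have h2 : r / 2 / (‖N‖ + 1) * ‖N‖ < r / 2 := by
      rw [div_mul_eq_mul_div, div_lt_iff₀ (by positivity)]
      nlinarith [norm_nonneg N]
    linarith
  have hin : x₀ - s₁ • N ∈ Ω := by
    have := hcv.add_smul_sub_mem_interior' (x := x₀) (y := c) (t := s₁)
      (frontier_subset_closure hx₀) (by rwa [hO.interior_eq]) ⟨hs₁, hs₁1⟩
    rw [hO.interior_eq] at this
    have e : x₀ - s₁ • N = x₀ + s₁ • (c - x₀) := by
      rw [hN, ← neg_sub c x₀, smul_neg, sub_neg_eq_add]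
    rwa [e]
  have hev : ∀ᶠ t : ℝ in 𝓝 0, ‖t • τ‖ < r / 2 ∧ x₀ + t • τ - s₁ • N ∈ Ω := by
    refine Filter.Eventually.and ?_ ?_
    · have : ContinuousAt (fun t : ℝ => ‖t • τ‖) 0 := by fun_prop
      exact this.eventually (gt_mem_nhds (by simpa using half_pos hr))
    · have : ContinuousAt (fun t : ℝ => x₀ + t • τ - s₁ • N) 0 := by fun_prop
      exact this.eventually (hO.mem_nhds (by simpa using hin))
  obtain ⟨ε, hε, hev⟩ := Metric.eventually_nhds_iff.mp hev
  have key : ∀ t : ℝ, 0 < t → t < ε → ∃ s : ℝ, 0 ≤ s ∧ s * (κ / 2) ≤ u (x₀ + t • τ) ∧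
      x₀ + t • τ - s • N ∈ frontier Ω := by
    intro t ht htε
    obtain ⟨ht1, ht2⟩ := hev (y := t) (by rwa [dist_zero_right, Real.norm_of_nonneg ht.le])
    -- Ω lies strictly on one side of the hyperplane through x₀ parallel to ker Du(x₀), which
    -- contains x₀ + tτ. Moving from there along −N leads into Ω, hence across the boundary.
    have hout : x₀ + t • τ ∉ Ω := fun hmem => by
      have h1 := hneg _ hmem
      have h2 : ∑ i, ((x₀ + t • τ) i - x₀ i) * pd i u x₀ = t * ∑ i, τ i * pd i u x₀ := by
        rw [Finset.mul_sum]
        refine Finset.sum_congr rfl fun i _ => ?_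
        simp only [PiLp.add_apply, PiLp.smul_apply, smul_eq_mul]
        ring
      rw [h2, hτ, mul_zero] at h1
      exact lt_irrefl _ h1
    have hpc : IsPreconnected ((fun s : ℝ => x₀ + t • τ - s • N) '' Set.Icc 0 s₁) :=
      isPreconnected_Icc.image _ (by fun_prop)
    obtain ⟨y, ⟨s, hs, rfl⟩, hy⟩ := exists_mem_frontier_of_isPreconnected hpc hO
      ⟨_, ⟨s₁, ⟨hs₁.le, le_rfl⟩, rfl⟩, ht2⟩ ⟨_, ⟨0, ⟨le_rfl, hs₁.le⟩, rfl⟩, by simpa using hout⟩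
    refine ⟨s, hs.1, ?_, hy⟩
    -- Near x₀, `u` grows along N at rate at least κ/2, and it vanishes at the boundary point
    -- reached. So s is at most (2/κ) u(x₀ + tτ), which is o(t) because Du(x₀) annihilates τ.
    obtain ⟨θ, hθ, h⟩ := exists_eq_add_pd hu (x₀ + t • τ) (-(s • N))
    rw [← sub_eq_add_neg, hu0 _ hy] at h
    have h3 : ∑ i, (-(s • N)) i * pd i u (x₀ + t • τ + θ • -(s • N)) =
        -(s * g (x₀ + (t • τ + θ • -(s • N)))) := by
      rw [hg, Finset.mul_sum, ← Finset.sum_neg_distrib, ← add_assoc]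
      refine Finset.sum_congr rfl fun i _ => ?_
      simp only [PiLp.neg_apply, PiLp.smul_apply, smul_eq_mul]
      ring
    have h4 : κ / 2 ≤ g (x₀ + (t • τ + θ • -(s • N))) := by
      refine hball _ ((norm_add_le _ _).trans_lt ?_)
      have : ‖θ • -(s • N)‖ ≤ s₁ * ‖N‖ := by
        rw [norm_smul, norm_neg, norm_smul, Real.norm_of_nonneg hθ.1.le,
          Real.norm_of_nonneg hs.1, ← mul_assoc]
        refine mul_le_mul_of_nonneg_right ?_ (norm_nonneg _)
        nlinarith [hθ.1, hθ.2, hs.1, hs.2]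
      linarith
    rw [h3] at h
    have := mul_le_mul_of_nonneg_left h4 hs.1
    linarith
  set t : ℕ → ℝ := fun j => ε / (j + 2) with htdef
  have ht0 : ∀ j, 0 < t j := fun j => by positivity
  have htε : ∀ j, t j < ε := fun j => by
    rw [htdef]
    exact div_lt_self hε (by have : (0 : ℝ) ≤ j := Nat.cast_nonneg j; linarith)
  have htlim : Tendsto t atTop (𝓝 0) :=
    tendsto_const_nhds.div_atTop (tendsto_atTop_add_const_right _ _ tendsto_natCast_atTop_atTop)
  choose s hs0 hsu hsf using fun j => key (t j) (ht0 j) (htε j)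
  refine ⟨t, fun j => t j • τ - s j • N, ht0, htlim, fun j => ?_, ?_⟩
  · rw [← add_sub_assoc]
    exact hsf j
  have hslope : Tendsto (fun j => (t j)⁻¹ * u (x₀ + t j • τ)) atTop (𝓝 0) := by
    have h1 := hasDerivAt_line hu x₀ τ 0
    simp only [zero_smul, add_zero, hτ] at h1
    have h2 := hasDerivAt_iff_tendsto_slope_zero.mp h1
    have h3 : Tendsto t atTop (𝓝[≠] 0) :=
      tendsto_nhdsWithin_iff.mpr ⟨htlim, Eventually.of_forall fun j => (ht0 j).ne'⟩
    have h4 := h2.comp h3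
    simpa [Function.comp_def, hu0 x₀ hx₀] using h4
  have hst : Tendsto (fun j => (t j)⁻¹ * s j) atTop (𝓝 0) := by
    refine squeeze_zero (fun j => mul_nonneg (inv_nonneg.mpr (ht0 j).le) (hs0 j))
      (fun j => ?_) (by simpa using hslope.const_mul (2 / κ))
    have : s j ≤ 2 / κ * u (x₀ + t j • τ) := by
      have := hsu j
      rw [div_mul_eq_mul_div, le_div_iff₀ hκ]
      linarith
    calc (t j)⁻¹ * s j ≤ (t j)⁻¹ * (2 / κ * u (x₀ + t j • τ)) :=
          mul_le_mul_of_nonneg_left this (inv_nonneg.mpr (ht0 j).le)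
      _ = 2 / κ * ((t j)⁻¹ * u (x₀ + t j • τ)) := by ring
  have hlim : Tendsto (fun j => τ - ((t j)⁻¹ * s j) • N) atTop (𝓝 τ) := by
    simpa using tendsto_const_nhds.sub (hst.smul_const N)
  refine hlim.congr fun j => ?_
  change _ = (t j)⁻¹ • (t j • τ - s j • N)
  rw [smul_sub (t j)⁻¹, smul_smul, smul_smul, inv_mul_cancel₀ (ht0 j).ne', one_smul]

lemma continuous_qf_hm (hw : ContDiff ℝ 2 w) :
    Continuous fun p : Eu n × Eu n => qf (hm w p.1) p.2 := by
  refine continuous_finsetSum _ fun i _ => continuous_finsetSum _ fun j _ => ?_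
  have h1 : Continuous (pd i (pd j w)) :=
    continuous_pd (contDiff_pd j hw (by norm_num)) i
  have h2 : ∀ k : Fin n, Continuous fun p : Eu n × Eu n => p.2 k := fun k => by fun_prop
  exact ((h2 i).mul (h2 j)).mul (h1.comp continuous_fst)

lemma qf_smul (A : Matrix (Fin n) (Fin n) ℝ) (c : ℝ) (v : Fin n → ℝ) :
    qf A (c • v) = c ^ 2 * qf A v := by
  simp only [qf, Finset.mul_sum, Pi.smul_apply, smul_eq_mul]
  exact Finset.sum_congr rfl fun i _ => Finset.sum_congr rfl fun j _ => by ring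

/-- At a boundary point, a function vanishing on the boundary has first derivatives, and second
derivatives in tangential directions, proportional to those of a defining function. -/
lemma boundary_proportional (hO : IsOpen Ω) (hcv : Convex ℝ Ω) (hu : ContDiff ℝ 2 u)
    (hw : ContDiff ℝ 2 w) (hu0 : ∀ x ∈ frontier Ω, u x = 0) (hw0 : ∀ x ∈ frontier Ω, w x = 0)
    {x₀ c : Eu n} (hx₀ : x₀ ∈ frontier Ω) (hc : c ∈ Ω)
    (hneg : ∀ y ∈ Ω, ∑ i, (y i - x₀ i) * pd i u x₀ < 0) {μ : ℝ}
    (hμ : ∑ i, (x₀ i - c i) * pd i w x₀ = μ * ∑ i, (x₀ i - c i) * pd i u x₀) :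
    (∀ i, pd i w x₀ = μ * pd i u x₀) ∧
    ∀ τ : Fin n → ℝ, ∑ i, τ i * pd i u x₀ = 0 → qf (hm w x₀) τ = μ * qf (hm u x₀) τ := by
  have hu1 : ContDiff ℝ 1 u := hu.of_le (by norm_num)
  have hw1 : ContDiff ℝ 1 w := hw.of_le (by norm_num)
  have hμu : ContDiff ℝ 2 fun y => μ * u y := contDiff_const.mul hu
  -- `k` vanishes on the boundary, so Dk(x₀) annihilates tangent vectors, being limits of chord
  -- directions; by the choice of μ it annihilates x₀ − c too. Hence Dk(x₀) = 0, and the second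
  -- order Taylor term along the same chords gives D²k(τ, τ) = 0.
  set k : Eu n → ℝ := fun y => w y - μ * u y with hk
  have hk2 : ContDiff ℝ 2 k := hw.sub hμu
  have hk1 : ContDiff ℝ 1 k := hk2.of_le (by norm_num)
  have hk0 : ∀ x ∈ frontier Ω, k x = 0 := fun x hx => by simp [hk, hu0 x hx, hw0 x hx]
  have hpk : ∀ i, pd i k = fun y => pd i w y - μ * pd i u y := fun i => by
    rw [hk, pd_sub i hw1 (hμu.of_le (by norm_num)), pd_const_mul i μ hu1]
  have hkker : ∀ τ : Eu n, ∑ i, τ i * pd i u x₀ = 0 → ∑ i, τ i * pd i k x₀ = 0 := by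
    intro τ hτ
    obtain ⟨t, z, ht0, ht, hz, hzt⟩ := exists_frontier_seq hO hcv hu1 hu0 hx₀ hc hneg τ hτ
    have hz0 : Tendsto z atTop (𝓝 0) := by
      have := ht.smul hzt
      rw [zero_smul] at this
      refine this.congr fun j => ?_
      rw [smul_smul, mul_inv_cancel₀ (ht0 j).ne', one_smul]
    choose θ hθ h using fun j => exists_eq_add_pd hk1 x₀ (z j)
    have hξ : Tendsto (fun j => x₀ + θ j • z j) atTop (𝓝 x₀) := by
      have : Tendsto (fun j => θ j • z j) atTop (𝓝 0) := by
        refine squeeze_zero_norm (fun j => ?_) (tendsto_norm_zero.comp hz0)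
        rw [norm_smul, Real.norm_of_nonneg (hθ j).1.le]
        exact mul_le_of_le_one_left (norm_nonneg _) (hθ j).2.le
      simpa using this.const_add x₀
    have hlim : Tendsto (fun j => ∑ i, ((t j)⁻¹ • z j) i * pd i k (x₀ + θ j • z j)) atTop
        (𝓝 (∑ i, τ i * pd i k x₀)) := by
      refine tendsto_finsetSum _ fun i _ => Tendsto.mul ?_ ?_
      · have hc : Continuous fun y : Eu n => y i := by fun_prop
        exact (hc.tendsto τ).comp hzt
      · exact ((continuous_pd hk1 i).tendsto x₀).comp hξ
    refine tendsto_nhds_unique hlim (tendsto_const_nhds.congr fun j => ?_)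
    have h1 := h j
    rw [hk0 _ (hz j), hk0 _ hx₀, zero_add] at h1
    simp only [PiLp.smul_apply, smul_eq_mul, mul_assoc, ← Finset.mul_sum, ← h1, mul_zero]
  have hpos : 0 < ∑ i, (x₀ i - c i) * pd i u x₀ := by
    have h1 := hneg c hc
    have h2 : ∑ i, (x₀ i - c i) * pd i u x₀ = -∑ i, (c i - x₀ i) * pd i u x₀ := by
      rw [← Finset.sum_neg_distrib]
      exact Finset.sum_congr rfl fun i _ => by ring
    linarith
  have hkN : ∑ i, (x₀ i - c i) * pd i k x₀ = 0 := by
    simp only [hpk, mul_sub, Finset.sum_sub_distrib]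
    rw [hμ, Finset.mul_sum, sub_eq_zero]
    exact Finset.sum_congr rfl fun i _ => by ring
  have hkv : ∀ v : Eu n, ∑ i, v i * pd i k x₀ = 0 := fun v => by
    set P := ∑ i, (x₀ i - c i) * pd i u x₀ with hP
    set σ := (∑ i, v i * pd i u x₀) / P with hσ
    have e : ∀ g : Fin n → ℝ, ∑ i, (v - σ • (x₀ - c)) i * g i =
        (∑ i, v i * g i) - σ * ∑ i, (x₀ i - c i) * g i := fun g => by
      rw [Finset.mul_sum, ← Finset.sum_sub_distrib]
      refine Finset.sum_congr rfl fun i _ => ?_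
      simp only [PiLp.sub_apply, PiLp.smul_apply, smul_eq_mul]
      ring
    have h1 := hkker (v - σ • (x₀ - c)) (by
      rw [e fun i => pd i u x₀, ← hP, hσ, div_mul_cancel₀ _ hpos.ne', sub_self])
    rw [e fun i => pd i k x₀, hkN, mul_zero, sub_zero] at h1
    exact h1
  have hk' : ∀ i, pd i k x₀ = 0 := fun i => by
    have := hkv (EuclideanSpace.single i 1)
    simpa [Pi.single_apply] using this
  refine ⟨fun i => ?_, fun τ hτ => ?_⟩
  · have := hk' i
    rw [hpk] at this
    linarith
  · obtain ⟨t, z, ht0, ht, hz, hzt⟩ := exists_frontier_seq hO hcv hu1 hu0 hx₀ hc hneg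
      (WithLp.toLp 2 τ) hτ
    have hz0 : Tendsto z atTop (𝓝 0) := by
      have := ht.smul hzt
      rw [zero_smul] at this
      refine this.congr fun j => ?_
      rw [smul_smul, mul_inv_cancel₀ (ht0 j).ne', one_smul]
    choose θ hθ h using fun j => exists_eq_add_qf hk2 x₀ (z j)
    have hξ : Tendsto (fun j => x₀ + θ j • z j) atTop (𝓝 x₀) := by
      have : Tendsto (fun j => θ j • z j) atTop (𝓝 0) := by
        refine squeeze_zero_norm (fun j => ?_) (tendsto_norm_zero.comp hz0)
        rw [norm_smul, Real.norm_of_nonneg (hθ j).1.le]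
        exact mul_le_of_le_one_left (norm_nonneg _) (hθ j).2.le
      simpa using this.const_add x₀
    have hlim := ((continuous_qf_hm hk2).tendsto (x₀, WithLp.toLp 2 τ)).comp (hξ.prodMk_nhds hzt)
    have hzero : qf (hm k x₀) τ = 0 := by
      refine tendsto_nhds_unique hlim (tendsto_const_nhds.congr fun j => ?_)
      have h1 := h j
      rw [hk0 _ (hz j), hk0 _ hx₀] at h1
      simp only [hk', mul_zero, Finset.sum_const_zero, zero_add] at h1
      have h2 := qf_smul (hm k (x₀ + θ j • z j)) (t j)⁻¹ (z j)
      simp only [Function.comp_apply]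
      change 0 = qf _ ((t j)⁻¹ • ((z j : Eu n) : Fin n → ℝ))
      rw [h2]
      have : qf (hm k (x₀ + θ j • z j)) (z j) = 0 := by linarith
      rw [this, mul_zero]
    have hhm : ∀ i j, hm k x₀ i j = hm w x₀ i j - μ * hm u x₀ i j := fun i j => by
      have hw' : ContDiff ℝ 1 (pd j w) := contDiff_pd j hw (by norm_num)
      have hu' : ContDiff ℝ 1 (pd j u) := contDiff_pd j hu (by norm_num)
      rw [hm_apply, hpk, pd_sub i hw' (contDiff_const.mul hu'), pd_const_mul i μ hu']
      rfl
    have : qf (hm k x₀) τ = qf (hm w x₀) τ - μ * qf (hm u x₀) τ := by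
      simp only [qf, hhm, mul_sub, Finset.sum_sub_distrib, Finset.mul_sum]
      congr 1
      exact Finset.sum_congr rfl fun i _ => Finset.sum_congr rfl fun j _ => by ring
    linarith

/-- The derivative at a boundary point of a function that is largest there. -/
lemma pd_sum_nonneg_of_nonpos (hcv : Convex ℝ Ω) (hw : ContDiff ℝ 1 w)
    (hle : ∀ x ∈ closure Ω, w x ≤ 0) {x₀ c : Eu n} (hx₀ : x₀ ∈ closure Ω) (hc : c ∈ closure Ω)
    (h0 : w x₀ = 0) : 0 ≤ ∑ i, (x₀ i - c i) * pd i w x₀ := by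
  have hmax : IsLocalMaxOn w (closure Ω) x₀ := by
    refine IsMaxOn.localize fun x hx => ?_
    simpa [h0] using hle x hx
  have h1 := hmax.hasFDerivWithinAt_nonpos
    (hw.differentiable one_ne_zero x₀).hasFDerivAt.hasFDerivWithinAt
    (sub_mem_posTangentConeAt_of_segment_subset (hcv.closure.segment_subset hx₀ hc))
  rw [fderiv_eq_sum] at h1
  have : ∑ i, (x₀ i - c i) * pd i w x₀ = -∑ i, (c - x₀) i * pd i w x₀ := by
    rw [← Finset.sum_neg_distrib]
    refine Finset.sum_congr rfl fun i _ => ?_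
    simp only [PiLp.sub_apply]
    ring
  linarith

/-- A function with Laplacian bounded below that vanishes on the boundary is negative inside. -/
lemma exists_le_neg_of_laplacian (hn : 0 < n) (hO : IsOpen Ω) (hb : Bornology.IsBounded Ω)
    {m : ℝ} (hm0 : 0 < m) {c : Eu n} (hc : c ∈ Ω) :
    ∃ c₁ : ℝ, 0 < c₁ ∧ ∀ f : Eu n → ℝ, ContDiff ℝ 2 f → (∀ x ∈ frontier Ω, f x = 0) →
      (∀ x ∈ Ω, n * m ≤ (hm f x).trace) → f c ≤ -c₁ := by
  obtain ⟨r, hr, hball⟩ := Metric.isOpen_iff.mp hO c hc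
  refine ⟨m / 4 * r ^ 2, by positivity, fun f hf hf0 hlap => ?_⟩
  have hco : ∀ k, ContDiff ℝ 2 fun y : Eu n => y k - c k := fun k => by fun_prop
  have hsq : ∀ k, ContDiff ℝ 2 fun y : Eu n => (y k - c k) * (y k - c k) :=
    fun k => (hco k).mul (hco k)
  have hq : ContDiff ℝ 2 fun y : Eu n => m / 4 * ∑ k, (y k - c k) * (y k - c k) :=
    contDiff_const.mul (ContDiff.sum fun k _ => hsq k)
  have hpd1 : ∀ i k, pd i (fun y : Eu n => y k - c k) = fun _ => if i = k then 1 else 0 := by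
    intro i k
    rw [pd_sub i (by fun_prop) contDiff_const, pd_coord, pd_const]
    simp
  have hpdq : ∀ i, pd i (fun y : Eu n => m / 4 * ∑ k, (y k - c k) * (y k - c k)) =
      fun y => m / 2 * (y i - c i) := by
    intro i
    rw [pd_const_mul i _ (ContDiff.sum fun k _ => (hsq k).of_le (by norm_num)),
      pd_sum i Finset.univ (f := fun k (y : Eu n) => (y k - c k) * (y k - c k))
        fun k _ => (hsq k).of_le (by norm_num)]
    ext y
    have : ∀ k, pd i (fun y : Eu n => (y k - c k) * (y k - c k)) y =
        if i = k then 2 * (y k - c k) else 0 := fun k => by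
      rw [pd_mul i ((hco k).of_le (by norm_num)) ((hco k).of_le (by norm_num)), hpd1]
      split_ifs <;> ring
    simp only [this, Finset.sum_ite_eq, Finset.mem_univ, if_true]
    ring
  have hpdq2 : ∀ i y, pd i (pd i fun y : Eu n => m / 4 * ∑ k, (y k - c k) * (y k - c k)) y =
      m / 2 := by
    intro i y
    rw [hpdq, pd_const_mul i _ ((hco i).of_le (by norm_num)), hpd1]
    simp
  set q : Eu n → ℝ := fun y => m / 4 * ∑ k, (y k - c k) * (y k - c k) with hqdef
  -- q has Laplacian nm/2, smaller than that of `f`, so f − q has no interior maximum. On the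
  -- boundary q ≥ (m/4)r², as the ball of radius `r` about `c` lies in Ω.
  have hmp := le_of_critical_le hO hb (w := fun y => f y - q y) (B := -(m / 4 * r ^ 2))
    (hf.sub hq) (fun x hx => ?_) (fun x hx _ h2 => ?_) c (subset_closure hc)
  · simpa [hqdef] using hmp
  · rw [hf0 x hx, zero_sub, neg_le_neg_iff, hqdef]
    refine mul_le_mul_of_nonneg_left ?_ (by positivity)
    have hx' : x ∉ Metric.ball c r := fun h => by
      rw [hO.frontier_eq] at hx
      exact hx.2 (hball h)
    rw [Metric.mem_ball, not_lt] at hx'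
    have h3 : r ^ 2 ≤ dist x c ^ 2 := pow_le_pow_left₀ hr.le hx' 2
    rw [EuclideanSpace.dist_sq_eq] at h3
    refine h3.trans (le_of_eq (Finset.sum_congr rfl fun k _ => ?_))
    rw [Real.dist_eq, sq_abs, pow_two]
  · exfalso
    have h3 : ∀ i, pd i (pd i f) x - m / 2 ≤ 0 := fun i => by
      have h4 := h2 (Pi.single i 1)
      rw [qf_eq_dotProduct] at h4
      simp only [Matrix.mulVec_single_one, single_dotProduct, one_mul, Matrix.col_apply,
        hm_apply] at h4
      rw [pd_sub i (hf.of_le (by norm_num)) (hq.of_le (by norm_num)),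
        pd_sub i (contDiff_pd i hf (by norm_num)) (contDiff_pd i hq (by norm_num))] at h4
      rw [← hpdq2 i x]
      exact h4
    have h5 : (hm f x).trace ≤ ∑ _i : Fin n, m / 2 :=
      Finset.sum_le_sum fun i _ => by
        have := h3 i
        change pd i (pd i f) x ≤ _
        linarith
    have h6 := hlap x hx
    simp only [Finset.sum_const, Finset.card_univ, Fintype.card_fin, nsmul_eq_mul] at h5
    have : (0 : ℝ) < n * m := by positivity
    linarith

end

/-! ### Quadratic forms relative to a hyperplane -/

section

variable {n : ℕ}

lemma qf_add_smul {A : Matrix (Fin n) (Fin n) ℝ} (hA : ∀ i j, A i j = A j i) (s : ℝ)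
    (N τ : Fin n → ℝ) : qf A (τ + s • N) =
      s ^ 2 * qf A N + 2 * s * (∑ i, ∑ j, N i * τ j * A i j) + qf A τ := by
  have h1 : ∑ i, ∑ j, τ i * N j * A i j = ∑ i, ∑ j, N i * τ j * A i j := by
    rw [Finset.sum_comm]
    exact Finset.sum_congr rfl fun i _ => Finset.sum_congr rfl fun j _ => by rw [hA j i]; ring
  have h2 : ∀ i j, (τ + s • N) i * (τ + s • N) j * A i j = s ^ 2 * (N i * N j * A i j) +
      s * (N i * τ j * A i j) + s * (τ i * N j * A i j) + τ i * τ j * A i j := fun i j => by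
    simp only [Pi.add_apply, Pi.smul_apply, smul_eq_mul]
    ring
  simp only [qf, h2, Finset.sum_add_distrib, ← Finset.mul_sum, h1]
  ring

lemma sum_sq_le_of_abs_le {p : Fin n → ℝ} {R : ℝ} (h : ∀ i, |p i| ≤ R) :
    ∑ i, p i ^ 2 ≤ n * R ^ 2 := by
  calc ∑ i, p i ^ 2 ≤ ∑ _i : Fin n, R ^ 2 :=
        Finset.sum_le_sum fun i _ => sq_le_sq' (neg_le_of_abs_le (h i)) (le_of_abs_le (h i))
    _ = n * R ^ 2 := by simp

/-- A positive definite matrix is bounded if its determinant and its mixed terms are bounded and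
it is bounded above and below in the directions of a hyperplane `p^⊥`. -/
lemma exists_qf_le_of_hyperplane (n : ℕ) {c₀ c₂ R X : ℝ} (hc₀ : 0 < c₀) (hc₂ : 0 < c₂)
    (hR : 0 < R) (hX : 0 < X) {C₂ C₄ D : ℝ} (hC₂ : 0 < C₂) (hC₄ : 0 < C₄) (hD : 0 < D) :
    ∃ C : ℝ, 0 < C ∧ ∀ (A : Matrix (Fin n) (Fin n) ℝ) (p N : Fin n → ℝ), A.PosDef →
      (∀ i, |p i| ≤ R) → (∀ i, |N i| ≤ X) → c₀ ≤ ∑ i, N i * p i →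
      (∀ τ : Fin n → ℝ, ∑ i, τ i * p i = 0 → c₂ * ∑ i, τ i ^ 2 ≤ qf A τ ∧
        qf A τ ≤ C₂ * ∑ i, τ i ^ 2 ∧
        (∑ i, ∑ j, N i * τ j * A i j) ^ 2 ≤ C₄ * ∑ i, τ i ^ 2) →
      A.det ≤ D → ∀ v, qf A v ≤ C * ∑ i, v i ^ 2 := by
  set S := n * R ^ 2 / c₀ ^ 2 with hS
  set T := 2 + 2 * (S * (n * X ^ 2)) with hT
  set c₃ := c₂ / (4 * (1 + n * X ^ 2)) with hc₃
  set a₀ := 2 * C₄ / c₂ + c₂ / 2 with ha₀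
  have hS0 : 0 ≤ S := by positivity
  have hc₃0 : 0 < c₃ := by positivity
  have ha₀0 : 0 < a₀ := by positivity
  refine ⟨(2 * (S * a₀) + 2 * (C₂ * T)) + D / c₃ ^ (n - 1), by positivity, ?_⟩
  intro A p N hA hp hN hpN hτ hdet v
  have hsymm : ∀ i j, A i j = A j i := fun i j => by
    have := hA.1.apply i j
    simpa using this.symm
  have hP0 : 0 < ∑ i, N i * p i := hc₀.trans_le hpN
  have hN2 : ∑ i, N i ^ 2 ≤ n * X ^ 2 := sum_sq_le_of_abs_le hN
  have hdec : ∀ v : Fin n → ℝ, ∃ s : ℝ, ∃ τ : Fin n → ℝ, v = τ + s • N ∧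
      ∑ i, τ i * p i = 0 ∧ s ^ 2 ≤ S * ∑ i, v i ^ 2 := fun v => by
    refine ⟨(∑ i, v i * p i) / ∑ i, N i * p i, v - ((∑ i, v i * p i) / ∑ i, N i * p i) • N,
      by simp, ?_, ?_⟩
    · simp only [Pi.sub_apply, Pi.smul_apply, smul_eq_mul, sub_mul, mul_assoc,
        Finset.sum_sub_distrib, ← Finset.mul_sum]
      rw [div_mul_cancel₀ _ hP0.ne', sub_self]
    · have h1 := Finset.sum_mul_sq_le_sq_mul_sq Finset.univ v p
      have h2 := sum_sq_le_of_abs_le hp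
      have h3 : 0 ≤ ∑ i, v i ^ 2 := Finset.sum_nonneg fun i _ => sq_nonneg _
      rw [div_pow, div_le_iff₀ (by positivity)]
      have h4 : c₀ ^ 2 ≤ (∑ i, N i * p i) ^ 2 := pow_le_pow_left₀ hc₀.le hpN 2
      calc (∑ i, v i * p i) ^ 2 ≤ (∑ i, v i ^ 2) * (n * R ^ 2) :=
            h1.trans (mul_le_mul_of_nonneg_left h2 h3)
        _ = S * (∑ i, v i ^ 2) * c₀ ^ 2 := by
            rw [hS]
            field_simp
        _ ≤ S * (∑ i, v i ^ 2) * (∑ i, N i * p i) ^ 2 :=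
            mul_le_mul_of_nonneg_left h4 (by positivity)
  have hsq : ∀ (s : ℝ) (τ : Fin n → ℝ), ∑ i, (τ + s • N) i ^ 2 ≤
      2 * ∑ i, τ i ^ 2 + 2 * (s ^ 2 * (n * X ^ 2)) := fun s τ => by
    have h1 : ∑ i, (τ + s • N) i ^ 2 ≤ ∑ i, (2 * τ i ^ 2 + 2 * s ^ 2 * N i ^ 2) :=
      Finset.sum_le_sum fun i _ => by
        simp only [Pi.add_apply, Pi.smul_apply, smul_eq_mul]
        nlinarith [sq_nonneg (τ i - s * N i)]
    rw [Finset.sum_add_distrib, ← Finset.mul_sum, ← Finset.mul_sum] at h1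
    have := mul_le_mul_of_nonneg_left hN2 (by positivity : 0 ≤ 2 * s ^ 2)
    linarith
  have hv0 : 0 ≤ ∑ i, v i ^ 2 := Finset.sum_nonneg fun i _ => sq_nonneg _
  -- If the transversal entry is at most a₀, the parallelogram identity bounds the form by 2s² qf A
  -- N + 2 qf A τ. Otherwise `A` is bounded below in every direction, and the bound on the
  -- determinant turns this into an upper bound.
  by_cases ha : qf A N ≤ a₀
  · obtain ⟨s, τ, hv, hτp, hs⟩ := hdec v
    have h1 := qf_nonneg hA.posSemidef (τ + (-s) • N)
    have h2 := qf_add_smul hsymm s N τ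
    have h3 := qf_add_smul hsymm (-s) N τ
    rw [← hv] at h2
    have h4 := (hτ τ hτp).2.1
    have h5 : ∑ i, τ i ^ 2 ≤ T * ∑ i, v i ^ 2 := by
      have h6 := hsq (-s) v
      have h7 : v + (-s) • N = τ := by
        rw [hv]
        simp
      rw [h7] at h6
      have : s ^ 2 * (n * X ^ 2) ≤ S * (∑ i, v i ^ 2) * (n * X ^ 2) :=
        mul_le_mul_of_nonneg_right hs (by positivity)
      rw [hT]
      linarith [neg_sq s]
    have h8 : s ^ 2 * qf A N ≤ S * (∑ i, v i ^ 2) * a₀ :=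
      (mul_le_mul_of_nonneg_left ha (sq_nonneg s)).trans (mul_le_mul_of_nonneg_right hs ha₀0.le)
    have h9 := mul_le_mul_of_nonneg_left h5 hC₂.le
    have h10 : 0 ≤ D / c₃ ^ (n - 1) * ∑ i, v i ^ 2 := by positivity
    nlinarith
  · rw [not_le] at ha
    have hlow : ∀ v, c₃ * ∑ i, v i ^ 2 ≤ qf A v := fun v => by
      obtain ⟨s, τ, hv, hτp, -⟩ := hdec v
      obtain ⟨e1, -, e2⟩ := hτ τ hτp
      have h2 := qf_add_smul hsymm s N τ
      rw [← hv] at h2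
      set b := ∑ i, ∑ j, N i * τ j * A i j
      set t := ∑ i, τ i ^ 2
      have ht : 0 ≤ t := Finset.sum_nonneg fun i _ => sq_nonneg _
      have h3 : -(2 * C₄ / c₂ * s ^ 2 + c₂ / 2 * t) ≤ 2 * s * b := by
        have k1 : c₂ * b ^ 2 / (2 * C₄) ≤ c₂ / 2 * t := by
          rw [div_le_iff₀ (by positivity)]
          nlinarith
        have k2 : 0 ≤ (2 * C₄ * s + c₂ * b) ^ 2 / (2 * C₄ * c₂) := by positivity
        have k3 : (2 * C₄ * s + c₂ * b) ^ 2 / (2 * C₄ * c₂) =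
            2 * C₄ / c₂ * s ^ 2 + 2 * s * b + c₂ * b ^ 2 / (2 * C₄) := by
          field_simp
          ring
        linarith
      have h4 : a₀ * s ^ 2 ≤ qf A N * s ^ 2 :=
        mul_le_mul_of_nonneg_right ha.le (sq_nonneg s)
      have h5 : c₂ / 2 * (s ^ 2 + t) ≤ qf A v := by
        rw [ha₀] at h4
        linarith
      refine le_trans ?_ h5
      have h6 := hsq s τ
      rw [← hv] at h6
      have h7 : ∑ i, v i ^ 2 ≤ 2 * (1 + n * X ^ 2) * (s ^ 2 + t) := by
        have : 0 ≤ n * X ^ 2 * t := by positivity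
        have : 0 ≤ s ^ 2 := sq_nonneg s
        linarith
      calc c₃ * ∑ i, v i ^ 2 ≤ c₃ * (2 * (1 + n * X ^ 2) * (s ^ 2 + t)) :=
            mul_le_mul_of_nonneg_left h7 hc₃0.le
        _ = c₂ / 2 * (s ^ 2 + t) := by
            rw [hc₃]
            field_simp
            ring
    have h1 := qf_le_of_det_le hA hc₃0 hlow hdet v
    have h2 : 0 ≤ (2 * (S * a₀) + 2 * (C₂ * T)) * ∑ i, v i ^ 2 := by positivity
    linarith

/-- The components of `q` in the hyperplane `p^⊥` are controlled by the minors of `(p, q)`. -/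
lemma tangential_sq_le {p q τ : Fin n → ℝ} {R X C c₀ : ℝ} (hp : ∀ i, |p i| ≤ R) {N : Fin n → ℝ}
    (hN : ∀ i, |N i| ≤ X) (hc₀ : 0 < c₀) (hpN : c₀ ≤ ∑ i, N i * p i) (hX : 0 < X)
    (hpq : ∀ i j, |p j * q i - p i * q j| ≤ C) (hτ : ∑ i, τ i * p i = 0) :
    (∑ i, τ i * q i) ^ 2 ≤ (n * (X ^ 2 * (C * R)) / c₀ ^ 2) ^ 2 * n ^ 3 * ∑ i, τ i ^ 2 := by
  have hn : 0 < n := by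
    rcases Nat.eq_zero_or_pos n with h | h
    · subst h
      simp at hpN
      linarith
    · exact h
  have hC : 0 ≤ C := (abs_nonneg _).trans (hpq ⟨0, hn⟩ ⟨0, hn⟩)
  have hR : 0 ≤ R := (abs_nonneg _).trans (hp ⟨0, hn⟩)
  -- As τ is orthogonal to `p`, |p|²⟨τ, q⟩ involves only the minors. The factor |p|² is bounded
  -- below through its pairing with `N`.
  have h1 : (∑ i, τ i * q i) * ∑ j, p j ^ 2 =
      ∑ j, ∑ i, τ i * (p j * (p j * q i - p i * q j)) := by
    have e : ∀ j, ∑ i, τ i * (p j * (p j * q i - p i * q j)) =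
        p j ^ 2 * (∑ i, τ i * q i) - p j * q j * ∑ i, τ i * p i := fun j => by
      rw [Finset.mul_sum, Finset.mul_sum, ← Finset.sum_sub_distrib]
      exact Finset.sum_congr rfl fun i _ => by ring
    simp only [e, hτ, mul_zero, sub_zero]
    rw [mul_comm, Finset.sum_mul]
  have h2 : |(∑ i, τ i * q i) * ∑ j, p j ^ 2| ≤ n * ((C * R) * ∑ i, |τ i|) := by
    rw [h1]
    refine (Finset.abs_sum_le_sum_abs _ _).trans ?_
    calc ∑ j, |∑ i, τ i * (p j * (p j * q i - p i * q j))| ≤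
          ∑ _j : Fin n, (C * R) * ∑ i, |τ i| := Finset.sum_le_sum fun j _ => by
            refine (Finset.abs_sum_le_sum_abs _ _).trans ?_
            rw [Finset.mul_sum]
            refine Finset.sum_le_sum fun i _ => ?_
            rw [abs_mul, abs_mul, mul_comm]
            refine mul_le_mul_of_nonneg_right ?_ (abs_nonneg _)
            rw [mul_comm]
            exact mul_le_mul (hpq i j) (hp j) (abs_nonneg _) hC
      _ = n * ((C * R) * ∑ i, |τ i|) := by simp
  have h3 : c₀ ^ 2 ≤ n * X ^ 2 * ∑ j, p j ^ 2 := by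
    have e1 := Finset.sum_mul_sq_le_sq_mul_sq Finset.univ N p
    have e2 : c₀ ^ 2 ≤ (∑ i, N i * p i) ^ 2 := pow_le_pow_left₀ hc₀.le hpN 2
    have e3 := mul_le_mul_of_nonneg_right (sum_sq_le_of_abs_le hN)
      (Finset.sum_nonneg fun j _ => sq_nonneg (p j) : 0 ≤ ∑ j, p j ^ 2)
    linarith
  have h4 : |∑ i, τ i * q i| ≤ n * (X ^ 2 * (C * R)) / c₀ ^ 2 * (n * ∑ i, |τ i|) := by
    have hP : 0 ≤ ∑ j, p j ^ 2 := Finset.sum_nonneg fun j _ => sq_nonneg _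
    rw [abs_mul, abs_of_nonneg hP] at h2
    rw [div_mul_eq_mul_div, le_div_iff₀ (by positivity)]
    calc |∑ i, τ i * q i| * c₀ ^ 2 ≤ |∑ i, τ i * q i| * (n * X ^ 2 * ∑ j, p j ^ 2) :=
          mul_le_mul_of_nonneg_left h3 (abs_nonneg _)
      _ = n * X ^ 2 * (|∑ i, τ i * q i| * ∑ j, p j ^ 2) := by ring
      _ ≤ n * X ^ 2 * (n * ((C * R) * ∑ i, |τ i|)) :=
          mul_le_mul_of_nonneg_left h2 (by positivity)
      _ = n * (X ^ 2 * (C * R)) * (n * ∑ i, |τ i|) := by ring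
  have h5 : (∑ i, |τ i|) ^ 2 ≤ n * ∑ i, τ i ^ 2 := by
    have := sq_sum_le_card_mul_sum_sq (s := Finset.univ) (f := fun i => |τ i|)
    simpa using this
  calc (∑ i, τ i * q i) ^ 2 = |∑ i, τ i * q i| ^ 2 := (sq_abs _).symm
    _ ≤ (n * (X ^ 2 * (C * R)) / c₀ ^ 2 * (n * ∑ i, |τ i|)) ^ 2 :=
        pow_le_pow_left₀ (abs_nonneg _) h4 2
    _ = (n * (X ^ 2 * (C * R)) / c₀ ^ 2) ^ 2 * n ^ 2 * (∑ i, |τ i|) ^ 2 := by ring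
    _ ≤ (n * (X ^ 2 * (C * R)) / c₀ ^ 2) ^ 2 * n ^ 2 * (n * ∑ i, τ i ^ 2) :=
        mul_le_mul_of_nonneg_left h5 (by positivity)
    _ = _ := by ring

end

/-! ### The second derivative estimates on the boundary and inside -/

section

variable {n : ℕ} {Ω : Set (Eu n)} {G ψ h f ρ : Eu n → ℝ} {K m d L M : ℝ}

lemma exists_abs_sub_le (hb : Bornology.IsBounded Ω) (c : Eu n) :
    ∃ X : ℝ, 0 < X ∧ ∀ x ∈ closure Ω, ∀ i, |x i - c i| ≤ X := by
  obtain ⟨X, hX0, hX⟩ := exists_abs_le_of_isCompact hb.isCompact_closure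
    (u := fun i (x : Eu n) => x i - c i) fun i => by fun_prop
  exact ⟨X, hX0, fun x hx i => hX i x hx⟩

lemma abs_sum_mul_le_of_abs_le {a b : Fin n → ℝ} {X Y : ℝ} (ha : ∀ i, |a i| ≤ X)
    (hb : ∀ i, |b i| ≤ Y) : |∑ i, a i * b i| ≤ n * (X * Y) := by
  refine (Finset.abs_sum_le_sum_abs _ _).trans ?_
  calc ∑ i, |a i * b i| ≤ ∑ _i : Fin n, X * Y := Finset.sum_le_sum fun i _ => by
        rw [abs_mul]
        exact mul_le_mul (ha i) (hb i) (abs_nonneg _) ((abs_nonneg _).trans (ha i))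
    _ = n * (X * Y) := by simp

/-- The inequality of means combined with ψG ≥ m. It supplies the Laplacian hypothesis of
`exists_le_neg_of_laplacian`, hence the negativity of solutions. -/
lemma Admissible.mul_le_trace (hn : 0 < n) (hG1 : ∀ ξ, 1 ≤ G ξ) (hm0 : 0 < m)
    (D : Admissible Ω G K m d L M ψ h f) {x : Eu n} (hx : x ∈ closure Ω) :
    n * m ≤ (hm f x).trace := by
  have h1 := F_le_trace hn (D.f_pos x hx).posSemidef
  rw [D.f_eq x hx, le_div_iff₀ (by positivity)] at h1
  have h2 := D.ψ_ge x hx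
  have h3 := hG1 (gradient f x)
  have h4 : m ≤ ψ x * G (gradient f x) := by nlinarith
  have := mul_le_mul_of_nonneg_right h4 (Nat.cast_nonneg (α := ℝ) n)
  linarith

/-- The estimate for the mixed second derivatives at the boundary. -/
lemma Admissible.exists_mixed_le (hn : 0 < n) (hG : ContDiff ℝ 1 G)
    (hc : ConvexOn ℝ Set.univ G) (hG1 : ∀ ξ, 1 ≤ G ξ) (hO : IsOpen Ω)
    (hb : Bornology.IsBounded Ω) (hcv : Convex ℝ Ω) (hm0 : 0 < m) (hd0 : 0 < d)
    (hρ : ContDiff ℝ 3 ρ) {c : Eu n} (hcΩ : c ∈ Ω) (K L M : ℝ) :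
    ∃ C : ℝ, 0 < C ∧ ∀ ψ h f, Admissible Ω G K m d L M ψ h f →
      (∀ x ∈ frontier Ω, ∀ p q, pd q ρ x * pd p f x = pd p ρ x * pd q f x) →
      ∀ x ∈ frontier Ω, ∀ p q,
        |pd q ρ x * (∑ i, (x i - c i) * hm f x i p) -
          pd p ρ x * (∑ i, (x i - c i) * hm f x i q)| ≤ C := by
  obtain ⟨A, hA⟩ := Admissible.exists_tangential_le hn hG hc hG1 hO hb hm0 hd0 hρ K L M
  obtain ⟨X, hX0, hX⟩ := exists_abs_sub_le hb c
  have hρ1 : ∀ q, ContDiff ℝ 2 (pd q ρ) := fun q => contDiff_pd q hρ (by norm_num)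
  obtain ⟨R, hR0, hR⟩ := exists_abs_le_of_isCompact hb.isCompact_closure
    (u := fun i : Fin n × Fin n => pd i.1 (pd i.2 ρ))
    fun i => continuous_pd ((hρ1 i.2).of_le (by norm_num)) i.1
  refine ⟨|A| * (n * (X * (|L| + |M|))) + 2 * (|M| * (n * (X * R))) + 1, by positivity, ?_⟩
  intro ψ h f D hT x hx
  have hxc := frontier_subset_closure hx
  have hcc := subset_closure hcΩ
  have hf1 : ∀ p, ContDiff ℝ 1 (pd p f) := fun p => contDiff_pd p D.f_smooth (by norm_num)
  have hfs : ContDiff ℝ 1 f := D.f_smooth.of_le (by norm_num)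
  have hhs : ContDiff ℝ 1 h := D.h_smooth.of_le (by norm_num)
  have hρ1' : ∀ q, ContDiff ℝ 1 (pd q ρ) := fun q => (hρ1 q).of_le (by norm_num)
  have key : ∀ p q, -(|A| * (n * (X * (|L| + |M|))) + 2 * (|M| * (n * (X * R))) + 1) ≤
      pd q ρ x * (∑ i, (x i - c i) * hm f x i p) -
          pd p ρ x * (∑ i, (x i - c i) * hm f x i q) := by
    intro p q
    have hm1 := (hρ1' q).mul (hf1 p)
    have hm2 := (hρ1' p).mul (hf1 q)
    have hdiff : ContDiff ℝ 1 fun y => A * (h y - f y) := contDiff_const.mul (hhs.sub hfs)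
    -- The function is at most 0 and vanishes at `x`, so its derivative along x − c is nonnegative.
    -- Expanded, this is the mixed second derivative expression plus terms with only first
    -- derivatives of `f` and `h`.
    have h0 := pd_sum_nonneg_of_nonpos hcv (hdiff.add (hm1.sub hm2))
      (hA ψ h f D hT p q) hxc hcc (by
        rw [D.h_bd x hx, D.f_bd x hx, hT x hx p q]
        simp)
    have e : ∀ i, (x i - c i) * pd i (fun y => A * (h y - f y) +
          (pd q ρ y * pd p f y - pd p ρ y * pd q f y)) x =
        A * ((x i - c i) * (pd i h x - pd i f x)) +
        (pd q ρ x * ((x i - c i) * hm f x i p) - pd p ρ x * ((x i - c i) * hm f x i q)) +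
        (pd p f x * ((x i - c i) * pd i (pd q ρ) x) -
          pd q f x * ((x i - c i) * pd i (pd p ρ) x)) := fun i => by
      rw [pd_add i hdiff (hm1.sub hm2), pd_sub i hm1 hm2, pd_mul i (hρ1' q) (hf1 p),
        pd_mul i (hρ1' p) (hf1 q), pd_const_mul i A (hhs.sub hfs), pd_sub i hhs hfs, hm_apply,
        hm_apply]
      ring
    simp only [e, Finset.sum_add_distrib, Finset.sum_sub_distrib, ← Finset.mul_sum] at h0
    have b1 : |A * ∑ i, (x i - c i) * (pd i h x - pd i f x)| ≤
        |A| * (n * (X * (|L| + |M|))) := by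
      rw [abs_mul]
      refine mul_le_mul_of_nonneg_left (abs_sum_mul_le_of_abs_le (hX x hxc) fun i => ?_)
        (abs_nonneg _)
      refine (abs_sub _ _).trans (add_le_add ?_ ?_)
      · exact (D.pd_h_le x hxc i).trans (le_abs_self _)
      · exact (D.pd_f_le x hxc i).trans (le_abs_self _)
    have b2 : ∀ p q, |pd p f x * ∑ i, (x i - c i) * pd i (pd q ρ) x| ≤
        |M| * (n * (X * R)) := fun p q => by
      rw [abs_mul]
      exact mul_le_mul ((D.pd_f_le x hxc p).trans (le_abs_self _))
        (abs_sum_mul_le_of_abs_le (hX x hxc) fun i => hR (i, q) x hxc) (abs_nonneg _)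
        (abs_nonneg _)
    have b3 := le_of_abs_le b1
    have b4 := le_of_abs_le (b2 p q)
    have b5 := neg_le_of_abs_le (b2 q p)
    linarith
  intro p q
  rw [abs_le]
  refine ⟨key p q, ?_⟩
  -- Exchanging `p` and `q` changes the sign of the expression.
  have := key q p
  linarith

/-- The boundary estimate for the quadratic form of the Hessian. -/
theorem Admissible.exists_boundary_le (hn : 0 < n) (hG : ContDiff ℝ 1 G)
    (hc : ConvexOn ℝ Set.univ G) (hG1 : ∀ ξ, 1 ≤ G ξ) (hO : IsOpen Ω) (hne : Ω.Nonempty)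
    (hb : Bornology.IsBounded Ω) (hcv : Convex ℝ Ω) (hm0 : 0 < m) (hd0 : 0 < d)
    (hρ : ContDiff ℝ 3 ρ) (hρpos : ∀ x ∈ closure Ω, (hm ρ x).PosDef)
    (hρ0 : ∀ x ∈ frontier Ω, ρ x = 0) (hρneg : ∀ x ∈ Ω, ρ x < 0) (K L M : ℝ) :
    ∃ C : ℝ, 0 < C ∧ ∀ ψ h f, Admissible Ω G K m d L M ψ h f →
      ∀ x ∈ frontier Ω, ∀ v, qf (hm f x) v ≤ C * ∑ i, v i ^ 2 := by
  obtain ⟨c, hcΩ⟩ := hne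
  have hn' : (0 : ℝ) < n := by exact_mod_cast hn
  have hcc := subset_closure hcΩ
  obtain ⟨C₃, hC₃, H₃⟩ := Admissible.exists_mixed_le hn hG hc hG1 hO hb hcv hm0 hd0 hρ hcΩ K L M
  obtain ⟨X, hX0, hX⟩ := exists_abs_sub_le hb c
  have hρ2 : ContDiff ℝ 2 ρ := hρ.of_le (by norm_num)
  obtain ⟨R, hR0, hR⟩ := exists_abs_le_of_isCompact hb.isCompact_closure
    (u := fun i => pd i ρ) fun i => continuous_pd (hρ.of_le (by norm_num)) i
  obtain ⟨l, hl, hlh⟩ := Admissible.exists_le_qf_h hn hm0 hd0 K M hG1 Ω L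
  obtain ⟨c₁, hc₁, hfc⟩ := exists_le_neg_of_laplacian hn hO hb hm0 hcΩ
  obtain ⟨Γ, hΓ0, hΓ⟩ := exists_bound_of_coord hG M
  have hc₀ : 0 < -ρ c := neg_pos.mpr (hρneg c hcΩ)
  set L' := |L| + 1 with hL'
  set M' := |M| + 1 with hM'
  have hL'0 : 0 < L' := by positivity
  have hM'0 : 0 < M' := by positivity
  set C₄ := (n * (X ^ 2 * (C₃ * R)) / (-ρ c) ^ 2) ^ 2 * n ^ 3 with hC₄
  -- To be used with p = Dρ(x) and N = x − c. Convexity of ρ gives N·p ≥ −ρ(c); the tangential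
  -- constants are bounds for μ times bounds for D²h; C₄ comes from `tangential_sq_le`; the last
  -- constant bounds det D²f = (ψG)ⁿ.
  obtain ⟨C, hC, HC⟩ := exists_qf_le_of_hyperplane n hc₀
    (c₂ := c₁ / (n * (X * L')) * l) (by positivity) hR0 hX0
    (C₂ := n * (X * M') / c₁ * (n * L')) (C₄ := C₄) (D := ((|K| + 1) * Γ) ^ n)
    (by positivity) (by positivity) (by positivity)
  refine ⟨C, hC, fun ψ h f D x hx v => ?_⟩
  have hxc := frontier_subset_closure hx
  have hf2 : ContDiff ℝ 2 f := D.f_smooth.of_le (by norm_num)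
  have hfneg : ∀ y ∈ Ω, f y < 0 := fun y hy => by
    obtain ⟨c', hc', hfc'⟩ := exists_le_neg_of_laplacian hn hO hb hm0 hy
    have := hfc' f hf2 D.f_bd fun z hz => D.mul_le_trace hn hG1 hm0 (subset_closure hz)
    linarith
  have hfc1 : f c ≤ -c₁ :=
    hfc f hf2 D.f_bd fun z hz => D.mul_le_trace hn hG1 hm0 (subset_closure hz)
  have hρt : ∀ z ∈ frontier Ω, ∀ y ∈ Ω, ∑ i, (y i - z i) * pd i ρ z < 0 := fun z hz y hy => by
    have := pd_sum_le_sub hρ2 hcv.closure hρpos (frontier_subset_closure hz) (subset_closure hy)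
    rw [hρ0 z hz] at this
    linarith [hρneg y hy]
  have hht : ∀ y ∈ Ω, ∑ i, (y i - x i) * pd i h x ≤ f y := fun y hy => by
    have := pd_sum_le_sub D.h_smooth hcv.closure D.h_pos hxc (subset_closure hy)
    rw [D.h_bd x hx] at this
    linarith [D.h_le_f y (subset_closure hy)]
  have hft : ∑ i, (c i - x i) * pd i f x ≤ f c := by
    have := pd_sum_le_sub hf2 hcv.closure D.f_pos hxc hcc
    rw [D.f_bd x hx] at this
    linarith
  have hflip : ∀ (z : Eu n) (g : Fin n → ℝ), ∑ i, (z i - c i) * g i = -∑ i, (c i - z i) * g i :=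
    fun z g => by
      rw [← Finset.sum_neg_distrib]
      exact Finset.sum_congr rfl fun i _ => by ring
  have hprop : ∀ w : Eu n → ℝ, ContDiff ℝ 2 w → (∀ y ∈ frontier Ω, w y = 0) →
      ∀ z ∈ frontier Ω, ∃ ν : ℝ, ∀ i, pd i w z = ν * pd i ρ z := fun w hw hw0 z hz => by
    have hpos : 0 < ∑ i, (z i - c i) * pd i ρ z := by
      rw [hflip]
      linarith [hρt z hz c hcΩ]
    exact ⟨_, (boundary_proportional hO hcv hρ2 hw hρ0 hw0 hz hcΩ (hρt z hz)
      (div_mul_cancel₀ _ hpos.ne').symm).1⟩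
  have htan : ∀ z ∈ frontier Ω, ∀ p q, pd q ρ z * pd p f z = pd p ρ z * pd q f z :=
    fun z hz p q => by
      obtain ⟨ν, hν⟩ := hprop f hf2 D.f_bd z hz
      rw [hν p, hν q]
      ring
  -- `h` and `f` are convex, vanish at `x` and satisfy h ≤ f, so both derivatives along x − c are at
  -- least −f(c) ≥ c₁. With the gradient bounds this keeps their quotient μ between positive
  -- constants.
  have hhN : c₁ ≤ ∑ i, (x i - c i) * pd i h x := by
    rw [hflip]
    linarith [hht c hcΩ]
  have hfN : c₁ ≤ ∑ i, (x i - c i) * pd i f x := by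
    rw [hflip]
    linarith
  have hhN' : ∑ i, (x i - c i) * pd i h x ≤ n * (X * L') :=
    (le_abs_self _).trans (abs_sum_mul_le_of_abs_le (hX x hxc) fun i =>
      (D.pd_h_le x hxc i).trans ((le_abs_self L).trans (by linarith)))
  have hfN' : ∑ i, (x i - c i) * pd i f x ≤ n * (X * M') :=
    (le_abs_self _).trans (abs_sum_mul_le_of_abs_le (hX x hxc) fun i =>
      (D.pd_f_le x hxc i).trans ((le_abs_self M).trans (by linarith)))
  set hN := ∑ i, (x i - c i) * pd i h x with hNdef
  set fN := ∑ i, (x i - c i) * pd i f x with fNdef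
  have hN0 : 0 < hN := hc₁.trans_le hhN
  set μ := fN / hN with hμ
  have hμ1 : c₁ / (n * (X * L')) ≤ μ := div_le_div₀ (hc₁.le.trans hfN) hfN hN0 hhN'
  have hμ2 : μ ≤ n * (X * M') / c₁ := div_le_div₀ (by positivity) hfN' hc₁ hhN
  have hμ0 : 0 < μ := lt_of_lt_of_le (by positivity) hμ1
  -- Here `h` plays the part of the defining function, so D²f = μ D²h on tangent vectors.
  obtain ⟨-, hsec⟩ := boundary_proportional hO hcv D.h_smooth hf2 D.h_bd D.f_bd hx hcΩ
    (fun y hy => (hht y hy).trans_lt (hfneg y hy)) (μ := μ) (div_mul_cancel₀ _ hN0.ne').symm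
  obtain ⟨ν, hν⟩ := hprop h D.h_smooth D.h_bd x hx
  have hpN : -ρ c ≤ ∑ i, (x i - c i) * pd i ρ x := by
    have := pd_sum_le_sub hρ2 hcv.closure hρpos hxc hcc
    rw [hρ0 x hx] at this
    rw [hflip]
    linarith
  refine HC (hm f x) (fun i => pd i ρ x) (fun i => x i - c i) (D.f_pos x hxc)
    (fun i => hR i x hxc) (hX x hxc) hpN (fun τ hτ => ?_) ?_ v
  · have hτh : ∑ i, τ i * pd i h x = 0 := by
      have : ∑ i, τ i * pd i h x = ν * ∑ i, τ i * pd i ρ x := by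
        rw [Finset.mul_sum]
        exact Finset.sum_congr rfl fun i _ => by rw [hν i]; ring
      rw [this, hτ, mul_zero]
    have hq := hsec τ hτh
    have ht0 : 0 ≤ ∑ i, τ i ^ 2 := Finset.sum_nonneg fun i _ => sq_nonneg _
    have hq1 := hlh ψ h f D x hxc τ
    have hq2 : qf (hm h x) τ ≤ n * L' * ∑ i, τ i ^ 2 := qf_le_of_entries (fun i j =>
      (D.hm_h_le x hxc i j).trans ((le_abs_self L).trans (by linarith))) τ
    refine ⟨?_, ?_, ?_⟩
    · rw [hq, mul_assoc]
      exact mul_le_mul hμ1 hq1 (by positivity) hμ0.le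
    · rw [hq, mul_assoc]
      exact mul_le_mul hμ2 hq2 (le_trans (by positivity) hq1) (by positivity)
    · have hmix := tangential_sq_le (p := fun i => pd i ρ x)
        (q := fun p => ∑ i, (x i - c i) * hm f x i p) (N := fun i => x i - c i)
        (fun i => hR i x hxc) (hX x hxc) hc₀ hpN hX0 (C := C₃)
        (fun p q => H₃ ψ h f D htan x hx p q) hτ
      have e : ∑ i, ∑ j, (x i - c i) * τ j * hm f x i j =
          ∑ j, τ j * ∑ i, (x i - c i) * hm f x i j := by
        rw [Finset.sum_comm]
        refine Finset.sum_congr rfl fun j _ => ?_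
        rw [Finset.mul_sum]
        exact Finset.sum_congr rfl fun i _ => by ring
      rw [e]
      exact hmix
  · rw [← F_pow hn (D.f_pos x hxc), D.f_eq x hxc]
    have hg := hΓ (gradient f x) fun i => by rw [gradient_apply]; exact D.pd_f_le x hxc i
    have hψ0 : 0 < ψ x := hm0.trans_le (D.ψ_ge x hxc)
    have hG0 : 0 < G (gradient f x) := zero_lt_one.trans_le (hG1 _)
    refine pow_le_pow_left₀ (by positivity) (mul_le_mul ?_ hg.1 hG0.le (by positivity)) n
    exact (D.ψ_le x hxc).trans ((le_abs_self K).trans (by linarith))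

/-- The estimate of the second derivatives by their values on the boundary. -/
theorem Admissible.exists_trace_le (hn : 0 < n) (hG : ContDiff ℝ 1 G)
    (hc : ConvexOn ℝ Set.univ G) (hG1 : ∀ ξ, 1 ≤ G ξ) (hO : IsOpen Ω)
    (hb : Bornology.IsBounded Ω) (hm0 : 0 < m) (K L M C₁ : ℝ) :
    ∃ C : ℝ, 0 < C ∧ ∀ ψ h f, Admissible Ω G K m d L M ψ h f →
      (∀ x ∈ closure Ω, ∀ k, |pd k (pd k ψ) x| ≤ K) →
      (∀ x ∈ frontier Ω, (hm f x).trace ≤ C₁) →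
      ∀ x ∈ closure Ω, (hm f x).trace ≤ C := by
  obtain ⟨Γ, hΓ0, hΓ⟩ := exists_bound_of_coord hG M
  have hn' : (0 : ℝ) < n := by exact_mod_cast hn
  set C₂ := n * (2 * (|K| * (n * Γ))) with hC₂
  -- C₂ is the coefficient of the trace in the error of the twice differentiated equation. Up to
  -- constants, (A/2)|Df|² contributes at least A(m/n) tr D²f = (C₂ + 1) tr D²f, so one full trace
  -- is left over.
  set A := n * (C₂ + 1) / m with hA
  have hC₂0 : 0 ≤ C₂ := by positivity
  have hA0 : 0 < A := by positivity
  set Q := A / 2 * (n * M ^ 2) with hQ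
  set C₀ := n * (|K| * Γ) + A * (n * (|M| * (|K| * Γ))) with hC₀
  refine ⟨|C₁| + C₀ + Q + 1, by positivity, fun ψ h f D hψ2 hbd => ?_⟩
  have hf2 : ContDiff ℝ 2 f := D.f_smooth.of_le (by norm_num)
  have hk3 : ∀ k, ContDiff ℝ 3 (pd k f) := fun k => contDiff_pd k D.f_smooth (by norm_num)
  have hk2 : ∀ k, ContDiff ℝ 2 (pd k f) := fun k => (hk3 k).of_le (by norm_num)
  have hkk : ∀ k, ContDiff ℝ 2 (pd k (pd k f)) := fun k => contDiff_pd k (hk3 k) (by norm_num)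
  have hlap : ContDiff ℝ 2 fun y => ∑ k, pd k (pd k f) y := ContDiff.sum fun k _ => hkk k
  have hsq1 : ∀ k, ContDiff ℝ 2 fun y => pd k f y * pd k f y := fun k => (hk2 k).mul (hk2 k)
  have hsq : ContDiff ℝ 2 fun y => ∑ k, pd k f y * pd k f y := ContDiff.sum fun k _ => hsq1 k
  have hAsq : ContDiff ℝ 2 fun y => A / 2 * ∑ k, pd k f y * pd k f y := contDiff_const.mul hsq
  have hsqle : ∀ x ∈ closure Ω, A / 2 * ∑ k, pd k f x * pd k f x ≤ Q := fun x hx => by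
    refine mul_le_mul_of_nonneg_left ?_ (by positivity)
    simpa only [pow_two] using sum_sq_le_of_abs_le (D.pd_f_le x hx)
  have hsqge : ∀ x, 0 ≤ A / 2 * ∑ k, pd k f x * pd k f x := fun x =>
    mul_nonneg (by positivity) (Finset.sum_nonneg fun k _ => mul_self_nonneg _)
  have htr : ∀ x, (hm f x).trace = ∑ k, pd k (pd k f) x := fun x => rfl
  have hmax := le_of_critical_le hO hb (B := |C₁| + C₀ + Q) (hlap.add hAsq)
    (fun x hx => ?_) fun x hx h1 h2 => ?_
  · intro x hx
    have := hmax x hx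
    rw [htr]
    linarith [hsqge x]
  · have e1 := hbd x hx
    rw [htr] at e1
    have e2 : 0 ≤ C₀ := by positivity
    linarith [hsqle x (frontier_subset_closure hx), le_abs_self C₁]
  · have hxc := subset_closure hx
    set a := dF (hm f x) with ha
    set b := drift G ψ f x with hbdef
    have hps : a.PosSemidef := dF_posSemidef (D.f_pos x hxc)
    have hneg := sum_mul_nonpos hps h2
    have hle : lop a b (fun y => (∑ k, pd k (pd k f) y) +
        A / 2 * ∑ k, pd k f y * pd k f y) x ≤ 0 := by
      rw [lop]
      simp only [h1, mul_zero, Finset.sum_const_zero, sub_zero]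
      exact hneg
    rw [lop_add a b hlap hAsq, lop_const_mul a b _ hsq, lop_sum a b Finset.univ fun k _ => hkk k,
      lop_sum a b Finset.univ (f := fun k y => pd k f y * pd k f y) fun k _ => hsq1 k] at hle
    have hg := hΓ (gradient f x) fun i => by rw [gradient_apply]; exact D.pd_f_le x hxc i
    have hψ0 : 0 < ψ x := hm0.trans_le (D.ψ_ge x hxc)
    have hG0 : 0 < G (gradient f x) := zero_lt_one.trans_le (hG1 _)
    have hKabs := le_abs_self K
    set T := ∑ k, pd k (pd k f) x with hT
    have hent : ∀ l k, |pd l (pd k f) x| ≤ T := fun l k =>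
      abs_apply_le_trace (D.f_pos x hxc).posSemidef l k
    have hT0 : 0 ≤ T := (D.f_pos x hxc).posSemidef.trace_nonneg
    have hFm : m ≤ F (hm f x) := by
      rw [D.f_eq x hxc]
      nlinarith [D.ψ_ge x hxc, hG1 (gradient f x)]
    have s1 : ∀ k, -(|K| * Γ) - 2 * (|K| * (n * Γ)) * T ≤ lop a b (pd k (pd k f)) x := fun k => by
      refine le_trans ?_ (D.linearization hn hG hc hO hm0 hx k).2
      have e1 : |pd k (pd k ψ) x * G (gradient f x)| ≤ |K| * Γ := by
        rw [abs_mul, abs_of_pos hG0]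
        exact mul_le_mul ((hψ2 x hxc k).trans hKabs) hg.1 hG0.le (abs_nonneg _)
      have e2 : |pd k ψ x * ∑ l, pd l G (gradient f x) * pd l (pd k f) x| ≤
          |K| * (n * (Γ * T)) := by
        rw [abs_mul]
        exact mul_le_mul ((D.pd_ψ_le x hxc k).trans hKabs)
          (abs_sum_mul_le_of_abs_le hg.2 fun l => hent l k) (abs_nonneg _) (abs_nonneg _)
      have e3 := neg_le_of_abs_le e1
      have e4 := neg_le_of_abs_le e2
      linarith
    have s2 : ∀ k, -(|M| * (|K| * Γ)) * 2 + 2 * (m / n * pd k (pd k f) x) ≤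
        lop a b (fun y => pd k f y * pd k f y) x := fun k => by
      have hquad : ∑ i, ∑ j, a i j * (pd i (pd k f) x * pd j (pd k f) x) =
          F (hm f x) / n * pd k (pd k f) x := by
        have e : ∀ i, ∑ j, a i j * (pd i (pd k f) x * pd j (pd k f) x) =
            pd i (pd k f) x * if i = k then F (hm f x) / n else 0 := fun i => by
          rw [← dF_mul (D.f_pos x hxc) i k, Finset.mul_sum]
          exact Finset.sum_congr rfl fun j _ => by rw [hm_apply]; ring
        simp only [e, mul_ite, mul_zero, Finset.sum_ite_eq', Finset.mem_univ, if_true]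
        ring
      rw [lop_mul a b (dF_symm (D.f_pos x hxc)) (hk2 k) (hk2 k), hquad,
        (D.linearization hn hG hc hO hm0 hx k).1]
      have e1 : |pd k f x * (pd k ψ x * G (gradient f x))| ≤ |M| * (|K| * Γ) := by
        rw [abs_mul, abs_mul, abs_of_pos hG0]
        refine mul_le_mul ((D.pd_f_le x hxc k).trans (le_abs_self M)) ?_ (by positivity)
          (abs_nonneg _)
        exact mul_le_mul ((D.pd_ψ_le x hxc k).trans hKabs) hg.1 hG0.le (abs_nonneg _)
      have e2 := neg_le_of_abs_le e1
      have e3 : m / n * pd k (pd k f) x ≤ F (hm f x) / n * pd k (pd k f) x :=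
        mul_le_mul_of_nonneg_right (div_le_div_of_nonneg_right hFm hn'.le)
          (D.f_pos x hxc).posSemidef.diag_nonneg
      linarith
    have t1 := Finset.sum_le_sum fun k (_ : k ∈ Finset.univ) => s1 k
    have t2 := Finset.sum_le_sum fun k (_ : k ∈ Finset.univ) => s2 k
    simp only [Finset.sum_add_distrib, ← Finset.mul_sum, ← hT] at t2
    simp only [Finset.sum_const, Finset.card_univ, Fintype.card_fin, nsmul_eq_mul] at t1 t2
    have t3 := mul_le_mul_of_nonneg_left t2 (by positivity : 0 ≤ A / 2)
    have t4 : A * (m / n) = C₂ + 1 := by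
      rw [hA]
      field_simp
    have t5 : A / 2 * (2 * (m / n * T)) = (C₂ + 1) * T := by
      rw [← t4]
      ring
    have t6 : T ≤ C₀ := by
      rw [mul_add, t5] at t3
      rw [hC₀]
      linarith
    linarith [hsqle x hxc, abs_nonneg C₁]

end

/-! ### From global extensions back to norms on the closure -/

section

variable {n : ℕ} {Ω : Set (Eu n)} {G : Eu n → ℝ} {K m d L M : ℝ}

lemma trace_le_of_qf_le {A : Matrix (Fin n) (Fin n) ℝ} {C : ℝ}
    (h : ∀ v, qf A v ≤ C * ∑ i, v i ^ 2) : A.trace ≤ n * C := by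
  have h1 : ∀ i, A i i ≤ C := fun i => by
    have := h (Pi.single i 1)
    rw [qf_eq_dotProduct] at this
    simpa [Pi.single_apply] using this
  calc A.trace ≤ ∑ _i : Fin n, C := Finset.sum_le_sum fun i _ => h1 i
    _ = n * C := by simp

/-- The boundary estimate for global functions, without reference to a defining function. -/
lemma exists_boundary_trace_le (hn : 0 < n) (hG : ContDiff ℝ 1 G)
    (hc : ConvexOn ℝ Set.univ G) (hG1 : ∀ ξ, 1 ≤ G ξ) (hO : IsOpen Ω) (hne : Ω.Nonempty)
    (hb : Bornology.IsBounded Ω) (hcv : Convex ℝ Ω) (hm0 : 0 < m) (hd0 : 0 < d) (K L M : ℝ) :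
    ∃ C : ℝ, 0 < C ∧ ∀ ψ h f, Admissible Ω G K m d L M ψ h f →
      ∀ x ∈ frontier Ω, (hm f x).trace ≤ C := by
  -- If there is no admissible triple, any constant serves. Otherwise the solution of one fixed
  -- triple is a defining function for the estimate of all the others: strictly convex, zero on the
  -- boundary and negative inside.
  by_cases hex : ∃ ψ h f, Admissible Ω G K m d L M ψ h f
  · obtain ⟨ψ₀, h₀, ρ, D₀⟩ := hex
    have hρneg : ∀ x ∈ Ω, ρ x < 0 := fun x hx => by
      obtain ⟨c₁, hc₁, H⟩ := exists_le_neg_of_laplacian hn hO hb hm0 hx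
      have := H ρ (D₀.f_smooth.of_le (by norm_num)) D₀.f_bd fun z hz =>
        D₀.mul_le_trace hn hG1 hm0 (subset_closure hz)
      linarith
    obtain ⟨C, hC, H⟩ := Admissible.exists_boundary_le hn hG hc hG1 hO hne hb hcv hm0 hd0
      (D₀.f_smooth.of_le (by norm_num)) D₀.f_pos D₀.f_bd hρneg K L M
    have hn' : (0 : ℝ) < n := by exact_mod_cast hn
    exact ⟨n * C, by positivity, fun ψ h f D x hx => trace_le_of_qf_le (H ψ h f D x hx)⟩
  · exact ⟨1, one_pos, fun ψ h f D => (hex ⟨ψ, h, f, D⟩).elim⟩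

section Within

variable {u g : Eu n → ℝ} {x : Eu n}

/-- A convex set with nonempty interior determines derivatives at all its points, so derivatives
within the closure are those of any extension. -/
lemma uniqueDiffOn_closure (hO : IsOpen Ω) (hne : Ω.Nonempty) (hcv : Convex ℝ Ω) :
    UniqueDiffOn ℝ (closure Ω) :=
  uniqueDiffOn_convex hcv.closure (hne.mono (interior_maximal subset_closure hO))

lemma iteratedFDerivWithin_closure_eq (hΩ : UniqueDiffOn ℝ (closure Ω)) {k : ℕ}
    (hg : ContDiff ℝ k g) (he : Set.EqOn u g (closure Ω)) (hx : x ∈ closure Ω) :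
    iteratedFDerivWithin ℝ k u (closure Ω) x = iteratedFDeriv ℝ k g x := by
  rw [iteratedFDerivWithin_congr he hx, iteratedFDerivWithin_eq_iteratedFDeriv hΩ hg.contDiffAt hx]

lemma iteratedFDeriv_two_single (hg : ContDiff ℝ 2 g) (i j : Fin n) :
    iteratedFDeriv ℝ 2 g x ![EuclideanSpace.single i 1, EuclideanSpace.single j 1] =
      pd i (pd j g) x := by
  rw [iteratedFDeriv_two_apply]
  exact snd_fderiv_apply hg i j x

lemma hess_eq (hΩ : UniqueDiffOn ℝ (closure Ω)) (hg : ContDiff ℝ 2 g)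
    (he : Set.EqOn u g (closure Ω)) (hx : x ∈ closure Ω) : hess Ω u x = hm g x := by
  ext i j
  simp only [hess, Matrix.of_apply]
  rw [iteratedFDerivWithin_closure_eq hΩ (k := 2) hg he hx, iteratedFDeriv_two_single hg]
  rfl

lemma grad_eq (hΩ : UniqueDiffOn ℝ (closure Ω)) (hg : ContDiff ℝ 1 g)
    (he : Set.EqOn u g (closure Ω)) (hx : x ∈ closure Ω) : grad Ω u x = gradient g x := by
  rw [grad, gradientWithin, gradient, fderivWithin_congr he (he hx),
    (hg.differentiable one_ne_zero x).fderivWithin (hΩ x hx)]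

/-- A real supremum over an unbounded family is 0 by default; boundedness is what lets `ckNorm`
dominate pointwise values. -/
lemma bddAbove_range_norm (hΩ : UniqueDiffOn ℝ (closure Ω)) (hb : Bornology.IsBounded Ω)
    (hu : SmoothOnClosure Ω u) (i : ℕ) :
    BddAbove (Set.range fun x : closure Ω => ‖iteratedFDerivWithin ℝ i u (closure Ω) x‖) := by
  obtain ⟨g, hg, he⟩ := hu i
  obtain ⟨C, hC⟩ := hb.isCompact_closure.exists_bound_of_continuousOn
    (hg.continuous_iteratedFDeriv le_rfl).continuousOn
  refine ⟨C, ?_⟩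
  rintro _ ⟨y, rfl⟩
  simp only [iteratedFDerivWithin_closure_eq hΩ hg he y.2]
  exact hC y y.2

lemma norm_le_ckNorm (hΩ : UniqueDiffOn ℝ (closure Ω)) (hb : Bornology.IsBounded Ω)
    (hu : SmoothOnClosure Ω u) {i k : ℕ} (hik : i ≤ k) (hx : x ∈ closure Ω) :
    ‖iteratedFDerivWithin ℝ i u (closure Ω) x‖ ≤ ckNorm Ω k u := by
  have h1 := le_ciSup (bddAbove_range_norm hΩ hb hu i) ⟨x, hx⟩
  refine h1.trans ?_
  exact Finset.single_le_sum
    (f := fun i => ⨆ x : closure Ω, ‖iteratedFDerivWithin ℝ i u (closure Ω) x‖)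
    (fun i _ => Real.iSup_nonneg fun _ => norm_nonneg _) (Finset.mem_range.mpr (by omega))

lemma ckNorm_succ (k : ℕ) : ckNorm Ω (k + 1) u =
    ckNorm Ω k u + ⨆ x : closure Ω, ‖iteratedFDerivWithin ℝ (k + 1) u (closure Ω) x‖ :=
  Finset.sum_range_succ _ _

lemma ckNorm_one_le_two : ckNorm Ω 1 u ≤ ckNorm Ω 2 u := by
  rw [ckNorm_succ 1]
  exact le_add_of_nonneg_right (Real.iSup_nonneg fun _ => norm_nonneg _)

lemma abs_pd_le_ckNorm (hΩ : UniqueDiffOn ℝ (closure Ω)) (hb : Bornology.IsBounded Ω)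
    (hu : SmoothOnClosure Ω u) {k : ℕ} (hk : 1 ≤ k) (hg : ContDiff ℝ 1 g)
    (he : Set.EqOn u g (closure Ω)) (hx : x ∈ closure Ω) (i : Fin n) :
    |pd i g x| ≤ ckNorm Ω k u := by
  have h1 := norm_le_ckNorm hΩ hb hu hk hx
  rw [iteratedFDerivWithin_closure_eq hΩ (k := 1) hg he hx] at h1
  refine le_trans ?_ h1
  have h2 := (iteratedFDeriv ℝ 1 g x).le_opNorm ![EuclideanSpace.single i 1]
  rw [iteratedFDeriv_one_apply] at h2
  simpa [pd] using h2

lemma abs_pd_pd_le_ckNorm (hΩ : UniqueDiffOn ℝ (closure Ω)) (hb : Bornology.IsBounded Ω)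
    (hu : SmoothOnClosure Ω u) (hg : ContDiff ℝ 2 g)
    (he : Set.EqOn u g (closure Ω)) (hx : x ∈ closure Ω) (i j : Fin n) :
    |pd i (pd j g) x| ≤ ckNorm Ω 2 u := by
  have h1 := norm_le_ckNorm hΩ hb hu (le_refl 2) hx
  rw [iteratedFDerivWithin_closure_eq hΩ (k := 2) hg he hx] at h1
  refine le_trans ?_ h1
  have h2 := (iteratedFDeriv ℝ 2 g x).le_opNorm
    ![EuclideanSpace.single i 1, EuclideanSpace.single j 1]
  rw [iteratedFDeriv_two_single hg] at h2
  simpa [Fin.prod_univ_two] using h2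

/-- By positivity the trace bounds each of the n² entries (`abs_apply_le_trace`). -/
lemma norm_iteratedFDeriv_two_le (hg : ContDiff ℝ 2 g) (hpos : (hm g x).PosSemidef) {C : ℝ}
    (hC : (hm g x).trace ≤ C) : ‖iteratedFDeriv ℝ 2 g x‖ ≤ n * n * C := by
  have hC0 : 0 ≤ C := hpos.trace_nonneg.trans hC
  refine ContinuousMultilinearMap.opNorm_le_bound (by positivity) fun v => ?_
  have h1 : iteratedFDeriv ℝ 2 g x v = ∑ i, ∑ j, v 0 i * v 1 j * hm g x i j := by
    rw [iteratedFDeriv_two_apply]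
    conv_lhs => rw [eu_eq_sum (v 0), eu_eq_sum (v 1)]
    simp only [map_sum, map_smul, FunLike.coe_sum, FunLike.coe_smul,
      Finset.sum_apply, Pi.smul_apply, smul_eq_mul, snd_fderiv_apply hg, hm_apply]
    rw [Finset.sum_comm]
    refine Finset.sum_congr rfl fun i _ => ?_
    rw [Finset.mul_sum]
    exact Finset.sum_congr rfl fun j _ => by ring
  rw [h1, Fin.prod_univ_two, Real.norm_eq_abs]
  refine (Finset.abs_sum_le_sum_abs _ _).trans ?_
  calc ∑ i, |∑ j, v 0 i * v 1 j * hm g x i j| ≤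
        ∑ _i : Fin n, ∑ _j : Fin n, C * (‖v 0‖ * ‖v 1‖) := by
        refine Finset.sum_le_sum fun i _ => (Finset.abs_sum_le_sum_abs _ _).trans ?_
        refine Finset.sum_le_sum fun j _ => ?_
        rw [abs_mul, abs_mul, mul_comm]
        refine mul_le_mul ((abs_apply_le_trace hpos i j).trans hC) ?_ (by positivity) hC0
        exact mul_le_mul (PiLp.norm_apply_le (v 0) i) (PiLp.norm_apply_le (v 1) j)
          (abs_nonneg _) (norm_nonneg _)
    _ = n * n * C * (‖v 0‖ * ‖v 1‖) := by
        simp only [Finset.sum_const, Finset.card_univ, Fintype.card_fin, nsmul_eq_mul]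
        ring

end Within

/-- The data are replaced by global extensions, C² for `φ` and `fhat` and C⁴ for `f`. Their values
and derivatives on the closure are those of the data, so the equation and all bounds carry over. -/
lemma exists_admissible (hO : IsOpen Ω) (hne : Ω.Nonempty) (hb : Bornology.IsBounded Ω)
    (hcv : Convex ℝ Ω) (hG1 : ∀ ξ, 1 ≤ G ξ) {φ fhat f : Eu n → ℝ} (hφ : SmoothOnClosure Ω φ)
    (hφ0 : ∀ x ∈ closure Ω, 0 < φ x) (hfhat : IsLowerBarrier Ω G φ fhat)
    (hf : IsSolution Ω G φ f) (hle : ∀ x ∈ closure Ω, fhat x ≤ f x) (hK : ckNorm Ω 1 φ ≤ K)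
    (hm : m ≤ infOnClosure Ω φ) (hd : d ≤ barrierGap Ω G φ fhat) (hL : ckNorm Ω 2 fhat ≤ L)
    (hM : ckNorm Ω 1 f ≤ M) :
    ∃ ψ h g, Admissible Ω G K m d L M ψ h g ∧ Set.EqOn φ ψ (closure Ω) ∧
      Set.EqOn f g (closure Ω) := by
  have hΩ := uniqueDiffOn_closure hO hne hcv
  obtain ⟨ψ, hψ, eψ⟩ := hφ 2
  obtain ⟨h, hh, eh⟩ := hfhat.convex.smooth 2
  obtain ⟨g, hg, eg⟩ := hf.convex.smooth 4
  have hψ' : ContDiff ℝ 2 ψ := hψ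
  have hh' : ContDiff ℝ 2 h := hh
  have hg' : ContDiff ℝ 4 g := hg
  have hg2 : ContDiff ℝ 2 g := hg'.of_le (by norm_num)
  have hfr : frontier Ω ⊆ closure Ω := frontier_subset_closure
  refine ⟨ψ, h, g, ?_, eψ, eg⟩
  refine
    { ψ_smooth := hψ', h_smooth := hh', f_smooth := hg', ψ_ge := fun x hx => ?_,
      ψ_le := fun x hx => ?_, pd_ψ_le := fun x hx i => ?_, h_pos := fun x hx => ?_,
      h_gap := fun x hx => ?_, pd_h_le := fun x hx i => ?_, hm_h_le := fun x hx i j => ?_,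
      h_bd := fun x hx => ?_, f_pos := fun x hx => ?_, f_eq := fun x hx => ?_,
      pd_f_le := fun x hx i => ?_, f_bd := fun x hx => ?_, h_le_f := fun x hx => ?_ }
  · rw [← eψ hx]
    -- A real infimum is known to lie below each value only for a family bounded below; positivity
    -- of `φ` provides the bound 0. For the gap, the barrier inequality does the same.
    refine hm.trans (ciInf_le ⟨0, ?_⟩ (⟨x, hx⟩ : closure Ω))
    rintro _ ⟨y, rfl⟩
    exact (hφ0 y y.2).le
  · rw [← eψ hx]
    have := norm_le_ckNorm hΩ hb hφ (Nat.zero_le 1) hx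
    rw [norm_iteratedFDerivWithin_zero] at this
    exact (le_abs_self _).trans (this.trans hK)
  · exact (abs_pd_le_ckNorm hΩ hb hφ le_rfl (hψ'.of_le (by norm_num)) eψ hx i).trans hK
  · rw [← hess_eq hΩ hh' eh hx]
    exact hfhat.convex.posDef x hx
  · rw [← hess_eq hΩ hh' eh hx, ← grad_eq hΩ (hh'.of_le (by norm_num)) eh hx, ← eψ hx]
    refine hd.trans (ciInf_le ⟨0, ?_⟩ (⟨x, hx⟩ : closure Ω))
    rintro _ ⟨y, rfl⟩
    have h1 := hfhat.ineq y y.2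
    rw [lt_div_iff₀ (zero_lt_one.trans_le (hG1 _))] at h1
    exact (sub_pos.mpr h1).le
  · exact (abs_pd_le_ckNorm hΩ hb hfhat.convex.smooth one_le_two (hh'.of_le (by norm_num))
      eh hx i).trans hL
  · exact (abs_pd_pd_le_ckNorm hΩ hb hfhat.convex.smooth hh' eh hx i j).trans hL
  · rw [← eh (hfr hx)]
    exact hfhat.boundary x hx
  · rw [← hess_eq hΩ hg2 eg hx]
    exact hf.convex.posDef x hx
  · rw [← hess_eq hΩ hg2 eg hx, ← grad_eq hΩ (hg'.of_le (by norm_num)) eg hx, ← eψ hx]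
    exact (div_eq_iff (zero_lt_one.trans_le (hG1 _)).ne').mp (hf.eqn x hx)
  · exact (abs_pd_le_ckNorm hΩ hb hf.convex.smooth le_rfl (hg'.of_le (by norm_num))
      eg hx i).trans hM
  · rw [← eg (hfr hx)]
    exact hf.boundary x hx
  · rw [← eh hx, ← eg hx]
    exact hle x hx

end

end CNS

end

theorem theorem2p27 {n : ℕ} (hn : 0 < n)
    (Ω : Set (EuclideanSpace ℝ (Fin n))) (hΩ_open : IsOpen Ω) (hΩ_ne : Ω.Nonempty)
    (hΩ_bdd : Bornology.IsBounded Ω) (hΩ_conv : Convex ℝ Ω)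
    (hΩ_smooth : CNS.HasSmoothBoundary Ω)
    (G : EuclideanSpace ℝ (Fin n) → ℝ) (hG_smooth : ContDiff ℝ ∞ G)
    (hG_conv : ConvexOn ℝ Set.univ G) (hG_one : ∀ ξ, 1 ≤ G ξ) :
    -- the boundary estimate
    (∀ K m d L M : ℝ, 0 < m → 0 < d → ∃ C : ℝ, 0 < C ∧
      ∀ φ fhat f : EuclideanSpace ℝ (Fin n) → ℝ,
        CNS.SmoothOnClosure Ω φ → (∀ x ∈ closure Ω, 0 < φ x) →
        CNS.IsLowerBarrier Ω G φ fhat → CNS.IsSolution Ω G φ f →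
        (∀ x ∈ closure Ω, fhat x ≤ f x) →
        CNS.ckNorm Ω 1 φ ≤ K → m ≤ CNS.infOnClosure Ω φ →
        d ≤ CNS.barrierGap Ω G φ fhat →
        CNS.ckNorm Ω 2 fhat ≤ L → CNS.ckNorm Ω 1 f ≤ M →
        ∀ x ∈ frontier Ω, ‖iteratedFDerivWithin ℝ 2 f (closure Ω) x‖ ≤ C) ∧
    -- the global estimate
    (∀ K m d L M : ℝ, 0 < m → 0 < d → ∃ C : ℝ, 0 < C ∧
      ∀ φ fhat f : EuclideanSpace ℝ (Fin n) → ℝ,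
        CNS.SmoothOnClosure Ω φ → (∀ x ∈ closure Ω, 0 < φ x) →
        CNS.IsLowerBarrier Ω G φ fhat → CNS.IsSolution Ω G φ f →
        (∀ x ∈ closure Ω, fhat x ≤ f x) →
        CNS.ckNorm Ω 2 φ ≤ K → m ≤ CNS.infOnClosure Ω φ →
        d ≤ CNS.barrierGap Ω G φ fhat →
        CNS.ckNorm Ω 2 fhat ≤ L → CNS.ckNorm Ω 1 f ≤ M →
        CNS.ckNorm Ω 2 f ≤ C) := by
  have hG1 : ContDiff ℝ 1 G := hG_smooth.of_le (by exact_mod_cast le_top)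
  have hU := CNS.uniqueDiffOn_closure hΩ_open hΩ_ne hΩ_conv
  have hn' : (0 : ℝ) < n := by exact_mod_cast hn
  refine ⟨fun K m d L M hm0 hd0 => ?_, fun K m d L M hm0 hd0 => ?_⟩
  · obtain ⟨C, hC, H⟩ := CNS.exists_boundary_trace_le hn hG1 hG_conv hG_one hΩ_open hΩ_ne
      hΩ_bdd hΩ_conv hm0 hd0 K L M
    refine ⟨n * n * C, by positivity, fun φ fhat f hφ hφ0 hfhat hf hle hK hm hd hL hM x hx => ?_⟩
    obtain ⟨ψ, h, g, D, -, eg⟩ := CNS.exists_admissible hΩ_open hΩ_ne hΩ_bdd hΩ_conv hG_one hφ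
      hφ0 hfhat hf hle hK hm hd hL hM
    have hxc := frontier_subset_closure hx
    have hg2 : ContDiff ℝ 2 g := D.f_smooth.of_le (by norm_num)
    rw [CNS.iteratedFDerivWithin_closure_eq hU (k := 2) hg2 eg hxc]
    exact CNS.norm_iteratedFDeriv_two_le hg2 (D.f_pos x hxc).posSemidef (H ψ h g D x hx)
  -- Since ‖φ‖₁ ≤ ‖φ‖₂ ≤ K, the boundary estimate applies with the same `K`; its trace bound C₁
  -- enters the interior estimate.
  · obtain ⟨C₁, hC₁, H₁⟩ := CNS.exists_boundary_trace_le hn hG1 hG_conv hG_one hΩ_open hΩ_ne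
      hΩ_bdd hΩ_conv hm0 hd0 K L M
    obtain ⟨C, hC, H⟩ := CNS.Admissible.exists_trace_le (Ω := Ω) (d := d) hn hG1 hG_conv hG_one
      hΩ_open hΩ_bdd hm0 K L M C₁
    refine ⟨|M| + n * n * C, by positivity,
      fun φ fhat f hφ hφ0 hfhat hf hle hK hm hd hL hM => ?_⟩
    obtain ⟨ψ, h, g, D, eψ, eg⟩ := CNS.exists_admissible hΩ_open hΩ_ne hΩ_bdd hΩ_conv hG_one hφ
      hφ0 hfhat hf hle (CNS.ckNorm_one_le_two.trans hK) hm hd hL hM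
    have hg2 : ContDiff ℝ 2 g := D.f_smooth.of_le (by norm_num)
    have : Nonempty (closure Ω) := hΩ_ne.closure.to_subtype
    rw [CNS.ckNorm_succ 1]
    refine add_le_add (hM.trans (le_abs_self M)) (ciSup_le fun x => ?_)
    rw [CNS.iteratedFDerivWithin_closure_eq hU (k := 2) hg2 eg x.2]
    refine CNS.norm_iteratedFDeriv_two_le hg2 (D.f_pos x x.2).posSemidef
      (H ψ h g D (fun y hy k => ?_) (H₁ ψ h g D) x x.2)
    exact (CNS.abs_pd_pd_le_ckNorm hU hΩ_bdd hφ D.ψ_smooth eψ hy k k).trans hK
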